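/- **Setting (hybrid-dynamic first-order logic with rigid symbols, HDFOLR).** A signature $\Delta$ consists of a set of nominals, a set of binary modalities, and a many-sorted first-order signature $\Sigma=(S,F,P)$ with a subsignature $\Sigma^{\mathtt r}=(S^{\mathtt r},F^{\mathtt r},P^{\mathtt r})$ of rigid symbols. Its extended rigid sorts are $S^{\mathtt e}=S^{\mathtt r}\cup\{\mathtt{any}\}$, where $\mathtt{any}$ is the sort of nominals, and its power is the larger of $\omega$ and the number of its symbols (sorts included). A Kripke structure $(W,M)$ over $\Delta$ consists of a non-empty set $W$ of worlds interpreting nominals as worlds and modalities as binary relations, and a $\Sigma$-structure $M_w$ with non-empty carriers for each world $w$, all $M_w$ having the same reduct to $\Sigma^{\mathtt r}$. Put $(W,M)_{\mathtt{any}}=W$ and $(W,M)_s=M_{w,s}$ for $s\in S^{\mathtt r}$. Hybrid terms are built from the symbols $\sigma\in F$ and the symbols $@_k\sigma$ ($k$ a nominal), the latter being interpreted at the world named by $k$, with $@_k x=x$ for rigid $x$; a term is rigid if every flexible symbol in it carries some $@_k$. Sentences are built from nominals, equations between hybrid terms, and relational atoms $\pi(t)$, $(@_k\pi)(t)$, by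 retrieve $@_k\gamma$, negation, finite disjunction, store ${\downarrow}z\,\gamma$, quantification $\exists X\,\gamma$ over a finite set $X$ of variables of sorts in $S^{\mathtt e}$, and possibility $\langle\mathfrak a\rangle\gamma$, where the action $\mathfrak a$ is built from modalities by composition, union and iteration. $(W,M)$ is a model of a theory (a set of sentences) if all its sentences hold at all worlds; $T\models\Gamma$ means that every model of $T$ is a model of $\Gamma$. For a sorted set $C=\{C_s\}_{s\in S^{\mathtt e}}$, the signature $\Delta[C]$ arises from $\Delta$ by adding the elements of $C$ as new nominals and new rigid constants. A substitution $\theta:C_1\to C_2$ over $\Delta$ maps each element of $C_{1}$ of sort $\mathtt{any}$ to a nominal of $\Delta[C_2]$ and each one of sort $s\in S^{\mathtt r}$ to a rigid term over $\Delta[C_2]$ of sort $s$; it acts on sentences, from $\Delta[C_1]$ to $\Delta[C_2]$. A fragment $\mathcal L$ of HDFOLR consists of a subcategory $\mathsf{Sig}^{\mathcal L}$ of the category of signatures and a subfunctor $\mathsf{Sen}^{\mathcal L}$ of the sentence functor on it, such that $\mathsf{Sig}^{\mathcal L}$ contains the inclusion $\Delta\hookrightarrow\Delta[C]$ for each of its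 objects $\Delta$ and each $C$, and $\mathsf{Sen}^{\mathcal L}$ is closed under substitutions and under subsentences (where $\langle\mathfrak a_1;\mathfrak a_2\rangle\gamma$ and $\langle\mathfrak a_1\cup\mathfrak a_2\rangle\gamma$ have the subsentences $\langle\mathfrak a_1\rangle\gamma$, $\langle\mathfrak a_2\rangle\gamma$, and with $\langle\mathfrak a^*\rangle\gamma$ some $\langle\mathfrak a^n\rangle\gamma$, $n\ge 1$, belongs to the fragment). $\mathcal L$ is semantically closed under a sentence-building operator if applying the operator to $\mathcal L$-sentences gives a sentence that holds in the same structures at the same worlds as some $\mathcal L$-sentence. Let $\alpha$ be an infinite cardinal and $\Delta$ a signature of $\mathcal L$. A theory $T\subseteq\mathsf{Sen}^{\mathcal L}(\Delta)$ $\alpha$-realizes a type $\Gamma\subseteq\mathsf{Sen}^{\mathcal L}(\Delta[X])$ in the variables $X$ if there are a sorted set $C$ of new constants with $\mathrm{card}(C_s)<\alpha$ for all $s\in S^{\mathtt e}$, a substitution $\theta:X\to C$ over $\Delta$, and a set $p\subseteq\mathsf{Sen}^{\mathcal L}(\Delta[C])$ with $\mathrm{card}(p)<\alpha$ such that $T\cup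 p$ is satisfiable and $T\cup p\models\theta(\Gamma)$; otherwise $T$ $\alpha$-omits $\Gamma$. A Kripke structure over $\Delta$ omits $\Gamma$ if none of its expansions to $\Delta[X]$ is a model of $\Gamma$. $\mathcal L$ has the $\alpha$-omitting types property ($\alpha$-OTP) if for every signature $\Delta$ of $\mathcal L$ of power at most $\alpha$, every satisfiable $T\subseteq\mathsf{Sen}^{\mathcal L}(\Delta)$ and every family $\{\Gamma^i\}_{i<\alpha}$ of types $\Gamma^i\subseteq\mathsf{Sen}^{\mathcal L}(\Delta[X^i])$, each in a finite set $X^i$ of variables of extended rigid sorts, such that $T$ $\alpha$-omits every $\Gamma^i$, there is a model of $T$ that omits every $\Gamma^i$. **Theorem (Upwards Löwenheim–Skolem).** Let $\mathcal L$ be a fragment of HDFOLR that is semantically closed under equality (of nominals and of hybrid terms), retrieve, negation, disjunction, possibility over binary modalities, and quantifiers. Let $\alpha$ be a regular cardinal such that $\mathcal L$ has the $\alpha$-OTP, let $\Delta$ be a signature of $\mathcal L$ of power at most $\alpha$, and let $(W,M)$ be a model of a theory $T\subseteq\mathsf{Sen}^{\mathcal L}(\Delta)$. Then there is a model $(V,N)$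 of $T$ such that $\mathrm{card}((V,N)_s)\ge\alpha$ for every $s\in S^{\mathtt e}$ for which $(W,M)_s$ is infinite. In fact, if $\Delta'$ is the signature obtained from $\Delta$ by adding a rigid binary relation symbol $\le$ on each sort $s\in S^{\mathtt e}$ for which $(W,M)_s$ is infinite (a new modality if $s=\mathtt{any}$), then $(V,N)$ has an expansion $(V',N')$ to $\Delta'$ in which $\langle (V',N')_s,\le\rangle$ is a linear ordering of cofinality $\alpha$ for every such $s$. -/

import Mathlib

/- Hybrid-dynamic first-order logic with rigid symbols (HDFOLR): signatures, Kripke structures,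
sentences, translations along signature morphisms and substitutions, fragments, and the omitting
types property. -/

universe u

namespace HDFOLR

/-! ### Signatures -/

/-- A signature. The nominal part consists of the nominals `Nom` and the binary modalities `Mod`.
The sorts are `RS ⊕ FS`, the rigid ones and the flexible ones; an arity is a finite string of
sorts, that is, a map `Fin n → _`. The rigid symbols `RF`, `RP` form a first-order signature over
the rigid sorts; the flexible symbols `FF`, `FP` (all the others) have arbitrary arities. -/
structure Sig : Type (u + 1) where
  Nom : Type u
  Mod : Type u
  RS : Type u
  FS : Type u
  RF : (n : ℕ) → (Fin n → RS) → RS → Type u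
  FF : (n : ℕ) → (Fin n → RS ⊕ FS) → RS ⊕ FS → Type u
  RP : (n : ℕ) → (Fin n → RS) → Type u
  FP : (n : ℕ) → (Fin n → RS ⊕ FS) → Type u

namespace Sig

/-- All sorts. -/
abbrev Srt (Δ : Sig.{u}) : Type u := Δ.RS ⊕ Δ.FS

/-- The extended rigid sorts: `none` is the sort `any` of nominals. -/
abbrev ESrt (Δ : Sig.{u}) : Type u := Option Δ.RS

/-- All function symbols, rigid or flexible, of arity `a` and sort `b`. A rigid one requires `a`
and `b` to consist of rigid sorts. -/
inductive Fn (Δ : Sig.{u}) {n : ℕ} (a : Fin n → Δ.Srt) (b : Δ.Srt) : Type u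
  | rig (ar : Fin n → Δ.RS) (s : Δ.RS) (ha : ∀ i, a i = Sum.inl (ar i)) (hb : b = Sum.inl s)
      (σ : Δ.RF n ar s) : Fn Δ a b
  | flex (σ : Δ.FF n a b) : Fn Δ a b

/-- All relation symbols, rigid or flexible, of arity `a`. -/
inductive Rl (Δ : Sig.{u}) {n : ℕ} (a : Fin n → Δ.Srt) : Type u
  | rig (ar : Fin n → Δ.RS) (ha : ∀ i, a i = Sum.inl (ar i)) (π : Δ.RP n ar) : Rl Δ a
  | flex (π : Δ.FP n a) : Rl Δ a

/-- The power of a signature: the number of its symbols, and at least `ℵ₀`. -/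
noncomputable def power (Δ : Sig.{u}) : Cardinal.{u} :=
  max Cardinal.aleph0
    (Cardinal.mk Δ.Nom + Cardinal.mk Δ.Mod + Cardinal.mk Δ.Srt
      + Cardinal.mk (Σ n : ℕ, Σ ar : Fin n → Δ.Srt, Σ s : Δ.Srt, Δ.Fn ar s)
      + Cardinal.mk (Σ n : ℕ, Σ ar : Fin n → Δ.Srt, Δ.Rl ar))

/-- The rigid function symbols of `Δ[C]`: those of `Δ` and, as constants, the elements of `C`. -/
inductive AddFn (Δ : Sig.{u}) (C : Δ.ESrt → Type u) :
    (n : ℕ) → (Fin n → Δ.RS) → Δ.RS → Type u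
  | old {n : ℕ} {ar : Fin n → Δ.RS} {s : Δ.RS} (σ : Δ.RF n ar s) : AddFn Δ C n ar s
  | new {ar : Fin 0 → Δ.RS} {s : Δ.RS} (c : C (some s)) : AddFn Δ C 0 ar s

/-- The signature `Δ[C]`, obtained by adding a sorted set `C` of new constants of extended rigid
sorts: new nominals for the sort `any`, new rigid constants for the rigid sorts. -/
abbrev add (Δ : Sig.{u}) (C : Δ.ESrt → Type u) : Sig.{u} where
  Nom := Δ.Nom ⊕ C none
  Mod := Δ.Mod
  RS := Δ.RS
  FS := Δ.FS
  RF := Δ.AddFn C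
  FF := Δ.FF
  RP := Δ.RP
  FP := Δ.FP

/-- A finite block of variables is a string of extended rigid sorts, its variables being the
positions; this is the corresponding sorted set. -/
def vars (Δ : Sig.{u}) {n : ℕ} (X : Fin n → Δ.ESrt) : Δ.ESrt → Type u :=
  fun e => ULift.{u} {i : Fin n // X i = e}

/-- `Δ[X]` for a finite block of variables `X`. -/
abbrev addVars (Δ : Sig.{u}) {n : ℕ} (X : Fin n → Δ.ESrt) : Sig.{u} := Δ.add (Δ.vars X)

/-- `Δ[z]` for a nominal variable `z`. -/
abbrev addNom (Δ : Sig.{u}) : Sig.{u} := Δ.addVars (fun _ : Fin 1 => none)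

/-- The modalities after adding a binary relation on each sort in `Ω`. -/
inductive OrdMod (Δ : Sig.{u}) (Ω : Set Δ.ESrt) : Type u
  | old (l : Δ.Mod) : OrdMod Δ Ω
  | le (h : none ∈ Ω) : OrdMod Δ Ω

/-- The rigid relation symbols after adding a binary relation on each sort in `Ω`. -/
inductive OrdRl (Δ : Sig.{u}) (Ω : Set Δ.ESrt) : (n : ℕ) → (Fin n → Δ.RS) → Type u
  | old {n : ℕ} {ar : Fin n → Δ.RS} (π : Δ.RP n ar) : OrdRl Δ Ω n ar
  | le (s : Δ.RS) (h : some s ∈ Ω) : OrdRl Δ Ω 2 (fun _ => s)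

/-- The signature obtained from `Δ` by adding, for each extended rigid sort in `Ω`, a new rigid
binary relation symbol on it: a modality for the sort `any`, a rigid relation symbol for a rigid
sort. -/
abbrev addOrders (Δ : Sig.{u}) (Ω : Set Δ.ESrt) : Sig.{u} where
  Nom := Δ.Nom
  Mod := Δ.OrdMod Ω
  RS := Δ.RS
  FS := Δ.FS
  RF := Δ.RF
  FF := Δ.FF
  RP := Δ.OrdRl Ω
  FP := Δ.FP

end Sig

/-! ### Actions, hybrid terms and sentences -/

/-- Structured actions over a set of modalities. -/
inductive Act (Λ : Type u) : Type u
  | atom (l : Λ) : Act Λ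
  | seq (a b : Act Λ) : Act Λ
  | union (a b : Act Λ) : Act Λ
  | star (a : Act Λ) : Act Λ

/-- `a.powSucc m` is the action `a ^ (m + 1)`. -/
def Act.powSucc {Λ : Type u} (a : Act Λ) : ℕ → Act Λ
  | 0 => a
  | m + 1 => .seq a (a.powSucc m)

def Act.map {Λ Λ' : Type u} (f : Λ → Λ') : Act Λ → Act Λ'
  | .atom l => .atom (f l)
  | .seq a b => .seq (a.map f) (b.map f)
  | .union a b => .union (a.map f) (b.map f)
  | .star a => .star (a.map f)

/-- Hybrid sorts: the rigid sorts `s`, the flexible sorts `s` (as `flex none s`), and the sorts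
`@ₖ s` with `s` flexible (as `flex (some k) s`). -/
inductive HSort (Δ : Sig.{u}) : Type u
  | rig (s : Δ.RS) : HSort Δ
  | flex (o : Option Δ.Nom) (s : Δ.FS) : HSort Δ

/-- The hybrid sort `s` (for `o = none`) or `@ₖ s` (for `o = some k`), where `@ₖ s = s` if `s` is
rigid. -/
def HSort.loc {Δ : Sig.{u}} (o : Option Δ.Nom) : Δ.Srt → HSort Δ
  | .inl s => .rig s
  | .inr s => .flex o s

/-- Hybrid terms. A flexible function symbol `σ` is used either as it is (`o = none`) or as `@ₖ σ`
(`o = some k`). -/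
inductive Term (Δ : Sig.{u}) : HSort Δ → Type u
  | rig {n : ℕ} {ar : Fin n → Δ.RS} {s : Δ.RS} (σ : Δ.RF n ar s)
      (args : ∀ i, Term Δ (.rig (ar i))) : Term Δ (.rig s)
  | flex (o : Option Δ.Nom) {n : ℕ} {ar : Fin n → Δ.Srt} {s : Δ.Srt} (σ : Δ.FF n ar s)
      (args : ∀ i, Term Δ (HSort.loc o (ar i))) : Term Δ (HSort.loc o s)

/-- Rigid terms: every flexible function symbol carries some `@ₖ`. -/
def Term.IsRigid {Δ : Sig.{u}} : {h : HSort Δ} → Term Δ h → Prop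
  | _, .rig _ args => ∀ i, (args i).IsRigid
  | _, .flex o _ args => o.isSome ∧ ∀ i, (args i).IsRigid

/-- Sentences. In order: nominal sentences, hybrid equations, hybrid relations for rigid symbols,
hybrid relations for symbols `π` (`o = none`) and `@ₖ π` (`o = some k`) with `π` flexible, retrieve,
negation, finite disjunction, store, existential quantification, possibility. -/
inductive Sen : Sig.{u} → Type (u + 1)
  | nom {Δ : Sig.{u}} (k : Δ.Nom) : Sen Δ
  | eq {Δ : Sig.{u}} {h : HSort Δ} (t₁ t₂ : Term Δ h) : Sen Δ
  | rrel {Δ : Sig.{u}} {n : ℕ} {ar : Fin n → Δ.RS} (π : Δ.RP n ar)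
      (t : ∀ i, Term Δ (.rig (ar i))) : Sen Δ
  | frel {Δ : Sig.{u}} (o : Option Δ.Nom) {n : ℕ} {ar : Fin n → Δ.Srt} (π : Δ.FP n ar)
      (t : ∀ i, Term Δ (HSort.loc o (ar i))) : Sen Δ
  | ret {Δ : Sig.{u}} (k : Δ.Nom) (γ : Sen Δ) : Sen Δ
  | neg {Δ : Sig.{u}} (γ : Sen Δ) : Sen Δ
  | disj {Δ : Sig.{u}} {n : ℕ} (Γ : Fin n → Sen Δ) : Sen Δ
  | store {Δ : Sig.{u}} (γ : Sen Δ.addNom) : Sen Δ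
  | ex {Δ : Sig.{u}} {n : ℕ} (X : Fin n → Δ.ESrt) (γ : Sen (Δ.addVars X)) : Sen Δ
  | dia {Δ : Sig.{u}} (a : Act Δ.Mod) (γ : Sen Δ) : Sen Δ

/-! ### Kripke structures and satisfaction -/

/-- The carriers of all sorts, from those of the rigid and of the flexible sorts. -/
def Carrier {A B : Type u} (R : A → Type u) (F : B → Type u) : A ⊕ B → Type u
  | .inl s => R s
  | .inr s => F s

/-- Kripke structures. Rigid sorts and rigid symbols have one interpretation, shared by all
worlds; flexible ones are interpreted in each world. -/
structure Kripke (Δ : Sig.{u}) : Type (u + 1) where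
  W : Type u
  W_nonempty : Nonempty W
  R : Δ.RS → Type u
  R_nonempty : ∀ s, Nonempty (R s)
  F : W → Δ.FS → Type u
  F_nonempty : ∀ w s, Nonempty (F w s)
  nom : Δ.Nom → W
  mod : Δ.Mod → W → W → Prop
  rf : ∀ {n : ℕ} {ar : Fin n → Δ.RS} {s : Δ.RS}, Δ.RF n ar s → (∀ i, R (ar i)) → R s
  ff : ∀ {n : ℕ} {ar : Fin n → Δ.Srt} {s : Δ.Srt}, Δ.FF n ar s →
    ∀ w, (∀ i, Carrier R (F w) (ar i)) → Carrier R (F w) s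
  rp : ∀ {n : ℕ} {ar : Fin n → Δ.RS}, Δ.RP n ar → (∀ i, R (ar i)) → Prop
  fp : ∀ {n : ℕ} {ar : Fin n → Δ.Srt}, Δ.FP n ar → ∀ w, (∀ i, Carrier R (F w) (ar i)) → Prop

namespace Kripke

variable {Δ : Sig.{u}}

/-- The carrier of an extended rigid sort; the set of worlds for the sort `any`. -/
def ECarrier (M : Kripke Δ) : Δ.ESrt → Type u
  | none => M.W
  | some s => M.R s

/-- The expansion of `M` to `Δ[C]` that interprets the new constants by `v`. Every expansion of
`M` to `Δ[C]` is of this form. -/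
abbrev expand (M : Kripke Δ) {C : Δ.ESrt → Type u} (v : ∀ e, C e → M.ECarrier e) :
    Kripke (Δ.add C) where
  W := M.W
  W_nonempty := M.W_nonempty
  R := M.R
  R_nonempty := M.R_nonempty
  F := M.F
  F_nonempty := M.F_nonempty
  nom := Sum.elim M.nom (v none)
  mod := M.mod
  rf := fun {_ _ _} σ => match σ with
    | .old σ => M.rf σ
    | .new c => fun _ => v (some _) c
  ff := M.ff
  rp := M.rp
  fp := M.fp

/-- The reduct to `Δ` of a structure over `Δ` with added binary relations. -/
def forgetOrders {Ω : Set Δ.ESrt} (M : Kripke (Δ.addOrders Ω)) : Kripke Δ where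
  W := M.W
  W_nonempty := M.W_nonempty
  R := M.R
  R_nonempty := M.R_nonempty
  F := M.F
  F_nonempty := M.F_nonempty
  nom := M.nom
  mod := fun l => M.mod (.old l)
  rf := M.rf
  ff := M.ff
  rp := fun π => M.rp (.old π)
  fp := M.fp

/-- The interpretation of the added binary relation symbol on a sort in `Ω`. -/
def ordRel {Ω : Set Δ.ESrt} (M : Kripke (Δ.addOrders Ω)) :
    (e : Δ.ESrt) → e ∈ Ω → M.ECarrier e → M.ECarrier e → Prop
  | none, h => fun x y => M.mod (.le h) x y
  | some s, h => fun x y => M.rp (.le s h) (Fin.cons x (Fin.cons y finZeroElim))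

/-- Accessibility relations of structured actions. -/
def acc (M : Kripke Δ) : Act Δ.Mod → M.W → M.W → Prop
  | .atom l => M.mod l
  | .seq a b => fun w w' => ∃ v, M.acc a w v ∧ M.acc b v w'
  | .union a b => fun w w' => M.acc a w w' ∨ M.acc b w w'
  | .star a => Relation.ReflTransGen (M.acc a)

/-- The world that `o` refers to when evaluated at `w`: `w` itself, or the one named by `k`. -/
def worldOf (M : Kripke Δ) (w : M.W) : Option Δ.Nom → M.W
  | none => w
  | some k => M.nom k

/-- The carrier of a hybrid sort, as seen from the world `w`. -/
def HCarrier (M : Kripke Δ) (w : M.W) : HSort Δ → Type u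
  | .rig s => M.R s
  | .flex o s => M.F (M.worldOf w o) s

/-- The carrier of `s` or `@ₖ s`, as seen from `w`, is that of `s` in the world referred to. -/
def ofLoc (M : Kripke Δ) (w : M.W) (o : Option Δ.Nom) :
    (s : Δ.Srt) → M.HCarrier w (HSort.loc o s) → Carrier M.R (M.F (M.worldOf w o)) s
  | .inl _, x => x
  | .inr _, x => x

def toLoc (M : Kripke Δ) (w : M.W) (o : Option Δ.Nom) :
    (s : Δ.Srt) → Carrier M.R (M.F (M.worldOf w o)) s → M.HCarrier w (HSort.loc o s)
  | .inl _, x => x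
  | .inr _, x => x

/-- The interpretation of hybrid terms at a world. -/
def eval (M : Kripke Δ) (w : M.W) : {h : HSort Δ} → Term Δ h → M.HCarrier w h
  | _, .rig σ args => M.rf σ (fun i => M.eval w (args i))
  | _, .flex (s := s) o σ args =>
      M.toLoc w o s (M.ff σ (M.worldOf w o) (fun i => M.ofLoc w o _ (M.eval w (args i))))

end Kripke

/-- Local satisfaction: `γ.Sat M w` says that `γ` holds in `M` at the world `w`. -/
def Sen.Sat : {Δ : Sig.{u}} → Sen Δ → (M : Kripke Δ) → M.W → Prop
  | _, .nom k, M, w => M.nom k = w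
  | _, .eq t₁ t₂, M, w => M.eval w t₁ = M.eval w t₂
  | _, .rrel π t, M, w => M.rp π (fun i => M.eval w (t i))
  | _, .frel o π t, M, w => M.fp π (M.worldOf w o) (fun i => M.ofLoc w o _ (M.eval w (t i)))
  | _, .ret k γ, M, _ => γ.Sat M (M.nom k)
  | _, .neg γ, M, w => ¬ γ.Sat M w
  | _, .disj Γ, M, w => ∃ i, (Γ i).Sat M w
  | Δ, .store γ, M, w =>
      γ.Sat (M.expand (C := Δ.vars (fun _ : Fin 1 => none))
        (fun e z => match e, z with
          | none, _ => w
          | some _, z => nomatch z.down.2)) w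
  | Δ, .ex X γ, M, w => ∃ v : (∀ e, Δ.vars X e → M.ECarrier e), γ.Sat (M.expand v) w
  | _, .dia a γ, M, w => ∃ w', M.acc a w w' ∧ γ.Sat M w'

/-- `M` is a (global) model of the set of sentences `T`. -/
def Kripke.Models {Δ : Sig.{u}} (M : Kripke Δ) (T : Set (Sen Δ)) : Prop :=
  ∀ γ ∈ T, ∀ w, γ.Sat M w

def Satisfiable {Δ : Sig.{u}} (T : Set (Sen Δ)) : Prop := ∃ M : Kripke Δ, M.Models T

/-- Global semantic consequence. -/
def Entails {Δ : Sig.{u}} (T Γ : Set (Sen Δ)) : Prop := ∀ M : Kripke Δ, M.Models T → M.Models Γ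

/-- Two sentences hold in the same structures at the same worlds. -/
def LocEquiv {Δ : Sig.{u}} (φ γ : Sen Δ) : Prop :=
  ∀ (M : Kripke Δ) (w : M.W), φ.Sat M w ↔ γ.Sat M w

/-! ### Signature morphisms and translations -/

/-- Signature morphisms. Rigid sorts and symbols are mapped to rigid ones, flexible sorts and
symbols to arbitrary ones. -/
structure Hom (Δ Δ' : Sig.{u}) : Type u where
  nom : Δ.Nom → Δ'.Nom
  mod : Δ.Mod → Δ'.Mod
  srt : Δ.Srt → Δ'.Srt
  rs : Δ.RS → Δ'.RS
  srt_rig : ∀ s, srt (Sum.inl s) = Sum.inl (rs s)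
  rf : ∀ {n : ℕ} {ar : Fin n → Δ.RS} {s : Δ.RS},
    Δ.RF n ar s → Δ'.RF n (fun i => rs (ar i)) (rs s)
  ff : ∀ {n : ℕ} {ar : Fin n → Δ.Srt} {s : Δ.Srt},
    Δ.FF n ar s → Δ'.Fn (fun i => srt (ar i)) (srt s)
  rp : ∀ {n : ℕ} {ar : Fin n → Δ.RS}, Δ.RP n ar → Δ'.RP n (fun i => rs (ar i))
  fp : ∀ {n : ℕ} {ar : Fin n → Δ.Srt}, Δ.FP n ar → Δ'.Rl (fun i => srt (ar i))

namespace Hom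

/-- The action of a signature morphism on all function symbols. -/
def fn {Δ Δ' : Sig.{u}} (χ : Hom Δ Δ') {n : ℕ} {a : Fin n → Δ.Srt} {b : Δ.Srt} :
    Δ.Fn a b → Δ'.Fn (fun i => χ.srt (a i)) (χ.srt b)
  | .rig ar s ha hb σ => .rig (fun i => χ.rs (ar i)) (χ.rs s)
      (fun i => by rw [ha i, χ.srt_rig]) (by rw [hb, χ.srt_rig]) (χ.rf σ)
  | .flex σ => χ.ff σ

/-- The action of a signature morphism on all relation symbols. -/
def rl {Δ Δ' : Sig.{u}} (χ : Hom Δ Δ') {n : ℕ} {a : Fin n → Δ.Srt} :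
    Δ.Rl a → Δ'.Rl (fun i => χ.srt (a i))
  | .rig ar ha π => .rig (fun i => χ.rs (ar i)) (fun i => by rw [ha i, χ.srt_rig]) (χ.rp π)
  | .flex π => χ.fp π

/-- The identity morphism. -/
def id (Δ : Sig.{u}) : Hom Δ Δ where
  nom := fun k => k
  mod := fun l => l
  srt := fun s => s
  rs := fun s => s
  srt_rig := fun _ => rfl
  rf := fun σ => σ
  ff := fun σ => .flex σ
  rp := fun π => π
  fp := fun π => .flex π

/-- Composition of morphisms, `ψ` after `χ`. -/
def comp {Δ Δ' Δ'' : Sig.{u}} (ψ : Hom Δ' Δ'') (χ : Hom Δ Δ') : Hom Δ Δ'' where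
  nom := fun k => ψ.nom (χ.nom k)
  mod := fun l => ψ.mod (χ.mod l)
  srt := fun s => ψ.srt (χ.srt s)
  rs := fun s => ψ.rs (χ.rs s)
  srt_rig := fun s => by rw [χ.srt_rig, ψ.srt_rig]
  rf := fun σ => ψ.rf (χ.rf σ)
  ff := fun σ => ψ.fn (χ.ff σ)
  rp := fun π => ψ.rp (χ.rp π)
  fp := fun π => ψ.rl (χ.fp π)

/-- The inclusion of `Δ` into `Δ[C]`. -/
def incl (Δ : Sig.{u}) (C : Δ.ESrt → Type u) : Hom Δ (Δ.add C) where
  nom := Sum.inl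
  mod := fun l => l
  srt := fun s => s
  rs := fun s => s
  srt_rig := fun _ => rfl
  rf := fun σ => .old σ
  ff := fun σ => .flex σ
  rp := fun π => π
  fp := fun π => .flex π

end Hom

/-- Common generalization of signature morphisms and substitutions, along which sentences are
translated: as a signature morphism, except that a rigid function symbol may also be mapped to a
term (for a substitution, a constant is). -/
structure Trans (Δ Δ' : Sig.{u}) : Type u where
  nom : Δ.Nom → Δ'.Nom
  mod : Δ.Mod → Δ'.Mod
  srt : Δ.Srt → Δ'.Srt
  rs : Δ.RS → Δ'.RS
  srt_rig : ∀ s, srt (Sum.inl s) = Sum.inl (rs s)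
  rf : ∀ {n : ℕ} {ar : Fin n → Δ.RS} {s : Δ.RS},
    Δ.RF n ar s → Δ'.RF n (fun i => rs (ar i)) (rs s) ⊕ Term Δ' (.rig (rs s))
  ff : ∀ {n : ℕ} {ar : Fin n → Δ.Srt} {s : Δ.Srt},
    Δ.FF n ar s → Δ'.Fn (fun i => srt (ar i)) (srt s)
  rp : ∀ {n : ℕ} {ar : Fin n → Δ.RS}, Δ.RP n ar → Δ'.RP n (fun i => rs (ar i))
  fp : ∀ {n : ℕ} {ar : Fin n → Δ.Srt}, Δ.FP n ar → Δ'.Rl (fun i => srt (ar i))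

def Hom.toTrans {Δ Δ' : Sig.{u}} (χ : Hom Δ Δ') : Trans Δ Δ' where
  nom := χ.nom
  mod := χ.mod
  srt := χ.srt
  rs := χ.rs
  srt_rig := χ.srt_rig
  rf := fun σ => .inl (χ.rf σ)
  ff := χ.ff
  rp := χ.rp
  fp := χ.fp

/-- Transport of a term between equal hybrid sorts. -/
def Term.transport {Δ : Sig.{u}} {h h' : HSort Δ} (e : h = h') (t : Term Δ h) : Term Δ h' := e ▸ t

/-- The term `σ(args)` or `(@ₖ σ)(args)`, where `@ₖ σ = σ` if `σ` is rigid. -/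
def Term.app {Δ : Sig.{u}} (o : Option Δ.Nom) {n : ℕ} {a : Fin n → Δ.Srt} {b : Δ.Srt} :
    Δ.Fn a b → (∀ i, Term Δ (HSort.loc o (a i))) → Term Δ (HSort.loc o b)
  | .rig _ _ ha hb σ, args =>
      (Term.rig σ (fun i => (args i).transport (congrArg (HSort.loc o) (ha i)))).transport
        (congrArg (HSort.loc o) hb).symm
  | .flex σ, args => .flex o σ args

/-- The sentence `π(t)` or `(@ₖ π)(t)`, where `@ₖ π = π` if `π` is rigid. -/
def Sen.rel {Δ : Sig.{u}} (o : Option Δ.Nom) {n : ℕ} {a : Fin n → Δ.Srt} :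
    Δ.Rl a → (∀ i, Term Δ (HSort.loc o (a i))) → Sen Δ
  | .rig _ ha π, t => .rrel π (fun i => (t i).transport (congrArg (HSort.loc o) (ha i)))
  | .flex π, t => .frel o π t

namespace Trans

variable {Δ Δ' : Sig.{u}}

/-- The action on hybrid sorts, `@ₖ s` being mapped to `@ₖ' s'` where `k'`, `s'` are the images of
`k`, `s`. -/
def hs (χ : Trans Δ Δ') : HSort Δ → HSort Δ'
  | .rig s => .rig (χ.rs s)
  | .flex o s => HSort.loc (o.map χ.nom) (χ.srt (Sum.inr s))

theorem hs_loc (χ : Trans Δ Δ') (o : Option Δ.Nom) (s : Δ.Srt) :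
    χ.hs (HSort.loc o s) = HSort.loc (o.map χ.nom) (χ.srt s) := by
  cases s with
  | inl s => rw [χ.srt_rig]; rfl
  | inr s => rfl

end Trans

/-- Translation of hybrid terms. -/
def Term.tr {Δ Δ' : Sig.{u}} (χ : Trans Δ Δ') : {h : HSort Δ} → Term Δ h → Term Δ' (χ.hs h)
  | _, .rig σ args =>
      match χ.rf σ with
      | .inl σ' => .rig σ' (fun i => (args i).tr χ)
      | .inr t => t
  | _, .flex o σ args =>
      (Term.app (o.map χ.nom) (χ.ff σ) (fun i => ((args i).tr χ).transport (χ.hs_loc o _))).transport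
        (χ.hs_loc o _).symm

/-- The extension `Δ[X] → Δ'[X']`, where `X'` has the same variables with translated sorts. -/
def Trans.lift {Δ Δ' : Sig.{u}} (χ : Trans Δ Δ') {n : ℕ} (X : Fin n → Δ.ESrt) :
    Trans (Δ.addVars X) (Δ'.addVars (fun i => (X i).map χ.rs)) where
  nom := Sum.map χ.nom (fun z => ⟨z.down.1, congrArg (Option.map χ.rs) z.down.2⟩)
  mod := χ.mod
  srt := χ.srt
  rs := χ.rs
  srt_rig := χ.srt_rig
  rf := fun {_ _ _} σ => match σ with
    | .old σ =>
        match χ.rf σ with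
        | .inl σ' => .inl (.old σ')
        | .inr t => .inr (t.tr (Hom.incl Δ' _).toTrans)
    | .new x => .inl (.new ⟨x.down.1, congrArg (Option.map χ.rs) x.down.2⟩)
  ff := fun σ => match χ.ff σ with
    | .rig ar s ha hb σ' => .rig ar s ha hb (.old σ')
    | .flex σ' => .flex σ'
  rp := χ.rp
  fp := fun π => match χ.fp π with
    | .rig ar ha π' => .rig ar ha π'
    | .flex π' => .flex π'

/-- Translation of sentences. -/
def Sen.tr : {Δ : Sig.{u}} → Sen Δ → {Δ' : Sig.{u}} → Trans Δ Δ' → Sen Δ'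
  | _, .nom k, _, χ => .nom (χ.nom k)
  | _, .eq t₁ t₂, _, χ => .eq (t₁.tr χ) (t₂.tr χ)
  | _, .rrel π t, _, χ => .rrel (χ.rp π) (fun i => (t i).tr χ)
  | _, .frel o π t, _, χ =>
      Sen.rel (o.map χ.nom) (χ.fp π) (fun i => ((t i).tr χ).transport (χ.hs_loc o _))
  | _, .ret k γ, _, χ => .ret (χ.nom k) (γ.tr χ)
  | _, .neg γ, _, χ => .neg (γ.tr χ)
  | _, .disj Γ, _, χ => .disj (fun i => (Γ i).tr χ)
  | _, .store γ, _, χ => .store (γ.tr (χ.lift _))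
  | _, .ex X γ, _, χ => .ex (fun i => (X i).map χ.rs) (γ.tr (χ.lift X))
  | _, .dia a γ, _, χ => .dia (a.map χ.mod) (γ.tr χ)

/-- A substitution `θ : C₁ → C₂` over `Δ`: it maps the new nominals to nominals of `Δ[C₂]` and the
new constants of a rigid sort to rigid terms over `Δ[C₂]` of that sort. -/
structure Subst (Δ : Sig.{u}) (C₁ C₂ : Δ.ESrt → Type u) : Type u where
  nom : C₁ none → (Δ.add C₂).Nom
  con : ∀ s : Δ.RS, C₁ (some s) → {t : Term (Δ.add C₂) (.rig s) // t.IsRigid}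

/-- The translation from `Δ[C₁]` to `Δ[C₂]` that preserves `Δ` and maps the constants in `C₁` as
the substitution prescribes. -/
def Subst.toTrans {Δ : Sig.{u}} {C₁ C₂ : Δ.ESrt → Type u} (θ : Subst Δ C₁ C₂) :
    Trans (Δ.add C₁) (Δ.add C₂) where
  nom := Sum.elim Sum.inl θ.nom
  mod := fun l => l
  srt := fun s => s
  rs := fun s => s
  srt_rig := fun _ => rfl
  rf := fun {_ _ _} σ => match σ with
    | .old σ => .inl (.old σ)
    | .new c => .inr (θ.con _ c).1
  ff := fun σ => .flex σ
  rp := fun π => π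
  fp := fun π => .flex π

/-! ### Fragments -/

/-- A fragment of HDFOLR: a subcategory of the category of signatures and a subfunctor of the
sentence functor on it, closed under adding new nominals and new rigid constants, under
substitutions, and under subsentences. -/
structure Fragment : Type (u + 1) where
  sig : Set Sig.{u}
  hom : ∀ Δ Δ' : Sig.{u}, Set (Hom Δ Δ')
  sen : ∀ Δ : Sig.{u}, Set (Sen Δ)
  id_mem : ∀ Δ ∈ sig, Hom.id Δ ∈ hom Δ Δ
  comp_mem : ∀ Δ ∈ sig, ∀ Δ' ∈ sig, ∀ Δ'' ∈ sig, ∀ χ ∈ hom Δ Δ', ∀ ψ ∈ hom Δ' Δ'',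
    ψ.comp χ ∈ hom Δ Δ''
  map_mem : ∀ Δ ∈ sig, ∀ Δ' ∈ sig, ∀ χ ∈ hom Δ Δ', ∀ γ ∈ sen Δ, γ.tr χ.toTrans ∈ sen Δ'
  add_mem : ∀ Δ ∈ sig, ∀ C : Δ.ESrt → Type u, Δ.add C ∈ sig
  incl_mem : ∀ Δ ∈ sig, ∀ C : Δ.ESrt → Type u, Hom.incl Δ C ∈ hom Δ (Δ.add C)
  subst_mem : ∀ Δ ∈ sig, ∀ (C₁ C₂ : Δ.ESrt → Type u) (θ : Subst Δ C₁ C₂),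
    ∀ γ ∈ sen (Δ.add C₁), γ.tr θ.toTrans ∈ sen (Δ.add C₂)
  seq_mem : ∀ Δ ∈ sig, ∀ (a b : Act Δ.Mod) (γ : Sen Δ), Sen.dia (.seq a b) γ ∈ sen Δ →
    Sen.dia a γ ∈ sen Δ ∧ Sen.dia b γ ∈ sen Δ
  union_mem : ∀ Δ ∈ sig, ∀ (a b : Act Δ.Mod) (γ : Sen Δ), Sen.dia (.union a b) γ ∈ sen Δ →
    Sen.dia a γ ∈ sen Δ ∧ Sen.dia b γ ∈ sen Δ
  star_mem : ∀ Δ ∈ sig, ∀ (a : Act Δ.Mod) (γ : Sen Δ), Sen.dia (.star a) γ ∈ sen Δ →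
    ∃ m : ℕ, Sen.dia (a.powSucc m) γ ∈ sen Δ
  dia_mem : ∀ Δ ∈ sig, ∀ (a : Act Δ.Mod) (γ : Sen Δ), Sen.dia a γ ∈ sen Δ → γ ∈ sen Δ
  neg_mem : ∀ Δ ∈ sig, ∀ γ : Sen Δ, Sen.neg γ ∈ sen Δ → γ ∈ sen Δ
  disj_mem : ∀ Δ ∈ sig, ∀ (n : ℕ) (Γ : Fin n → Sen Δ), Sen.disj Γ ∈ sen Δ → ∀ i, Γ i ∈ sen Δ
  ret_mem : ∀ Δ ∈ sig, ∀ (k : Δ.Nom) (γ : Sen Δ), Sen.ret k γ ∈ sen Δ → γ ∈ sen Δ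
  store_mem : ∀ Δ ∈ sig, ∀ γ : Sen Δ.addNom, Sen.store γ ∈ sen Δ → γ ∈ sen Δ.addNom
  ex_mem : ∀ Δ ∈ sig, ∀ (n : ℕ) (X : Fin n → Δ.ESrt) (γ : Sen (Δ.addVars X)),
    Sen.ex X γ ∈ sen Δ → γ ∈ sen (Δ.addVars X)

namespace Fragment

/-- Semantic closure under equality, of nominals and of hybrid terms. -/
def ClosedEq (L : Fragment.{u}) : Prop :=
  ∀ Δ ∈ L.sig, (∀ k : Δ.Nom, ∃ φ ∈ L.sen Δ, LocEquiv φ (.nom k)) ∧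
    ∀ (h : HSort Δ) (t₁ t₂ : Term Δ h), ∃ φ ∈ L.sen Δ, LocEquiv φ (.eq t₁ t₂)

/-- Semantic closure under retrieve. -/
def ClosedRet (L : Fragment.{u}) : Prop :=
  ∀ Δ ∈ L.sig, ∀ (k : Δ.Nom), ∀ γ ∈ L.sen Δ, ∃ φ ∈ L.sen Δ, LocEquiv φ (.ret k γ)

/-- Semantic closure under negation. -/
def ClosedNeg (L : Fragment.{u}) : Prop :=
  ∀ Δ ∈ L.sig, ∀ γ ∈ L.sen Δ, ∃ φ ∈ L.sen Δ, LocEquiv φ (.neg γ)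

/-- Semantic closure under disjunction. -/
def ClosedDisj (L : Fragment.{u}) : Prop :=
  ∀ Δ ∈ L.sig, ∀ (n : ℕ) (Γ : Fin n → Sen Δ), (∀ i, Γ i ∈ L.sen Δ) →
    ∃ φ ∈ L.sen Δ, LocEquiv φ (.disj Γ)

/-- Semantic closure under possibility over binary modalities. -/
def ClosedDia (L : Fragment.{u}) : Prop :=
  ∀ Δ ∈ L.sig, ∀ (l : Δ.Mod), ∀ γ ∈ L.sen Δ, ∃ φ ∈ L.sen Δ, LocEquiv φ (.dia (.atom l) γ)

/-- Semantic closure under quantifiers. -/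
def ClosedEx (L : Fragment.{u}) : Prop :=
  ∀ Δ ∈ L.sig, ∀ (n : ℕ) (X : Fin n → Δ.ESrt), ∀ γ ∈ L.sen (Δ.addVars X),
    ∃ φ ∈ L.sen Δ, LocEquiv φ (.ex X γ)

end Fragment

/-! ### Omitting types -/

/-- `M` realizes the type `Γ` with free variables `X`: some expansion of `M` to `Δ[X]` is a model
of `Γ`. -/
def Kripke.Realizes {Δ : Sig.{u}} (M : Kripke Δ) {X : Δ.ESrt → Type u}
    (Γ : Set (Sen (Δ.add X))) : Prop :=
  ∃ v : (∀ e, X e → M.ECarrier e), (M.expand v).Models Γ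

namespace Fragment

/-- The theory `T` over `Δ` `α`-realizes the type `Γ` with free variables `X`. -/
def AlphaRealizes (L : Fragment.{u}) (α : Cardinal.{u}) {Δ : Sig.{u}} (T : Set (Sen Δ))
    {X : Δ.ESrt → Type u} (Γ : Set (Sen (Δ.add X))) : Prop :=
  ∃ C : Δ.ESrt → Type u, (∀ e, Cardinal.mk (C e) < α) ∧
    ∃ (θ : Subst Δ X C) (p : Set (Sen (Δ.add C))), p ⊆ L.sen (Δ.add C) ∧
      Cardinal.mk p < Cardinal.lift.{u + 1} α ∧
      Satisfiable ((fun γ => γ.tr (Hom.incl Δ C).toTrans) '' T ∪ p) ∧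
      Entails ((fun γ => γ.tr (Hom.incl Δ C).toTrans) '' T ∪ p)
        ((fun γ => γ.tr θ.toTrans) '' Γ)

/-- The `α`-omitting types property: for all signatures of power at most `α`, all satisfiable
theories `T` and all families of `α` types, each in finitely many variables and `α`-omitted by `T`,
some model of `T` omits all types of the family. -/
def HasOTP (L : Fragment.{u}) (α : Cardinal.{u}) : Prop :=
  ∀ Δ ∈ L.sig, Δ.power ≤ α →
    ∀ T : Set (Sen Δ), T ⊆ L.sen Δ → Satisfiable T →
      ∀ (ι : Type u), Cardinal.mk ι = α →
        ∀ (X : ι → Δ.ESrt → Type u), (∀ i, Finite (Σ e, X i e)) →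
          ∀ Γ : (i : ι) → Set (Sen (Δ.add (X i))), (∀ i, Γ i ⊆ L.sen (Δ.add (X i))) →
            (∀ i, ¬ L.AlphaRealizes α T (Γ i)) →
              ∃ M : Kripke Δ, M.Models T ∧ ∀ i, ¬ M.Realizes (Γ i)

end Fragment

/-- `r` is a (reflexive) linear ordering of cofinality `α`. -/
def IsLinearOrderOfCof {A : Type u} (r : A → A → Prop) (α : Cardinal.{u}) : Prop :=
  ∃ o : LinearOrder A, (∀ x y, r x y ↔ o.le x y) ∧ Order.cof A = α

end HDFOLR

/-!
The new relation symbols impose no condition on the model of `T`: a set with at least `α` elements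
has a linear ordering of cofinality `α`, obtained by putting a copy of `α` on top of it
(`exists_isLinearOrderOfCof`). So it suffices to find a model of `T` in which the sorts that are
infinite in `M` have at least `α` elements. For `α = ℵ₀` this is `M` itself. Let `α > ℵ₀`.

Since the signatures of a fragment need not be closed under adding relation symbols, only new
constants are used. For each of the sorts in question there are constants `a n` for `n < ω` and
`b j`, `c k`, `d i` for `j, k, i < α`. For every limit `i` of cofinality `ω` a cofinal
`ω`-sequence `l i` below `i` is fixed. The theory (`Admissible`) says that the `a n` are distinct
from each other and from the `b j`, and that, for the set `C = {k | c k = a 0}`,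

* if `d i = a n`, then `C` has no element strictly between `l i n` and `i`;
* if `d i = b j`, then `C` has no element strictly between `j` and `i`.

The types to be omitted say that `x` is none of the `a n` and `b j`, and that `C` is bounded by
`j`, for each `j < α`. In a model that omits them everything is named and `C` is unbounded. If it
had fewer than `α` elements, they would all have names with indices below some `β < α`. Let `i` be
the supremum of an `ω`-sequence in `C` above `β`: then the value of `d i` bounds `C ∩ i` strictly
below `i`, a contradiction (`Admissible.cof_le_mk`).

The types are `α`-omitted because fewer than `α` sentences and the finitely many terms of a
substitution involve only constants with indices below some `β < α`, the cardinal `α` being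
regular. From `β` on the constants can be reinterpreted, keeping the theory true: `b β` may be any
element that is not one of the `a n`, `β` may be put into `C`, and it does no harm to have `C`
empty beyond `β`, because for `i > β` one can choose `d i = a n` with `l i n` above `β`
(`Admissible.exists_modification`).

The logical part consists of the satisfaction condition for inclusions and substitutions and of the
fact that a sentence depends on finitely many constants. Both follow from
`Sen.exists_finite_support`, which is proved by one induction on sentences.
-/

namespace HDFOLR

/-! ### Translations that change only nominals and rigid function symbols -/

section

/-- The signature `Δ` with its nominals replaced by `N` and its rigid function symbols by `G`. -/
abbrev Sig.upd (Δ : Sig.{u}) (N : Type u) (G : (n : ℕ) → (Fin n → Δ.RS) → Δ.RS → Type u) :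
    Sig.{u} where
  Nom := N
  Mod := Δ.Mod
  RS := Δ.RS
  FS := Δ.FS
  RF := G
  FF := Δ.FF
  RP := Δ.RP
  FP := Δ.FP

variable {Δ : Sig.{u}} {N : Type u} {G : (n : ℕ) → (Fin n → Δ.RS) → Δ.RS → Type u}

/-- The translation that is given by `f` on nominals, by `g` on rigid function symbols, and is the
identity on everything else. Inclusions `Δ → Δ[C]`, substitutions, and the extensions of both
under quantifiers are all of this form. -/
abbrev Trans.upd (f : Δ.Nom → N)
    (g : ∀ {n : ℕ} {ar : Fin n → Δ.RS} {s : Δ.RS},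
      Δ.RF n ar s → G n ar s ⊕ Term (Δ.upd N G) (.rig s)) :
    Trans Δ (Δ.upd N G) where
  nom := f
  mod := fun l => l
  srt := fun s => s
  rs := fun s => s
  srt_rig := fun _ => rfl
  rf := g
  ff := fun σ => .flex σ
  rp := fun π => π
  fp := fun π => .flex π

/-- The structure over `Δ.upd N G` that interprets `N` and `G` by `nm` and `rf`, and everything
else as `M` does. -/
abbrev Kripke.upd (M : Kripke Δ) (nm : N → M.W)
    (rf : ∀ {n : ℕ} {ar : Fin n → Δ.RS} {s : Δ.RS}, G n ar s → (∀ i, M.R (ar i)) → M.R s) :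
    Kripke (Δ.upd N G) where
  W := M.W
  W_nonempty := M.W_nonempty
  R := M.R
  R_nonempty := M.R_nonempty
  F := M.F
  F_nonempty := M.F_nonempty
  nom := nm
  mod := M.mod
  rf := rf
  ff := M.ff
  rp := M.rp
  fp := M.fp

/-- The nominals and rigid function symbols of a signature. -/
abbrev Sig.Sym (Δ : Sig.{u}) : Type u :=
  Δ.Nom ⊕ (Σ n : ℕ, Σ ar : Fin n → Δ.RS, Σ s : Δ.RS, Δ.RF n ar s)

/-- The interpretation of the symbol in `M` agrees with that of its translation in the updated
structure. -/
def Kripke.AgreeAt (M : Kripke Δ) (f : Δ.Nom → N)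
    (g : ∀ {n : ℕ} {ar : Fin n → Δ.RS} {s : Δ.RS},
      Δ.RF n ar s → G n ar s ⊕ Term (Δ.upd N G) (.rig s))
    (nm : N → M.W)
    (rf : ∀ {n : ℕ} {ar : Fin n → Δ.RS} {s : Δ.RS}, G n ar s → (∀ i, M.R (ar i)) → M.R s) :
    Δ.Sym → Prop
  | .inl k => nm (f k) = M.nom k
  | .inr ⟨_, _, s, σ⟩ => ∀ w args,
      Sum.elim (fun σ' => rf σ' args)
        (fun t => (M.upd nm rf).eval (h := .rig s) w t) (g σ) = M.rf σ args

theorem Kripke.eval_transport (M : Kripke Δ) (w : M.W) {h h' : HSort Δ} (e : h = h')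
    (t : Term Δ h) : HEq (M.eval w (t.transport e)) (M.eval w t) := by
  subst e; rfl

theorem Kripke.ofLoc_heq (M : Kripke Δ) (w : M.W) (o : Option Δ.Nom) (s : Δ.Srt)
    (x : M.HCarrier w (HSort.loc o s)) : HEq (M.ofLoc w o s x) x := by
  cases s <;> rfl

theorem Kripke.toLoc_heq (M : Kripke Δ) (w : M.W) (o : Option Δ.Nom) (s : Δ.Srt)
    (x : Carrier M.R (M.F (M.worldOf w o)) s) : HEq (M.toLoc w o s x) x := by
  cases s <;> rfl

theorem Kripke.ff_heq (M : Kripke Δ) {n : ℕ} {ar : Fin n → Δ.Srt} {s : Δ.Srt} (σ : Δ.FF n ar s)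
    {v v' : M.W} (hv : v = v') {a : ∀ i, Carrier M.R (M.F v) (ar i)}
    {a' : ∀ i, Carrier M.R (M.F v') (ar i)} (ha : ∀ i, HEq (a i) (a' i)) :
    HEq (M.ff σ v a) (M.ff σ v' a') := by
  subst hv
  rw [funext fun i => eq_of_heq (ha i)]

theorem Kripke.fp_iff (M : Kripke Δ) {n : ℕ} {ar : Fin n → Δ.Srt} (π : Δ.FP n ar)
    {v v' : M.W} (hv : v = v') {a : ∀ i, Carrier M.R (M.F v) (ar i)}
    {a' : ∀ i, Carrier M.R (M.F v') (ar i)} (ha : ∀ i, HEq (a i) (a' i)) :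
    M.fp π v a ↔ M.fp π v' a' := by
  subst hv
  rw [funext fun i => eq_of_heq (ha i)]

theorem eq_iff_of_heq {A B : Type u} {a a' : A} {b b' : B} (hAB : A = B) (h : HEq a b)
    (h' : HEq a' b') : a = a' ↔ b = b' := by
  subst hAB
  rw [eq_of_heq h, eq_of_heq h']

/-- The symbols, at most one, that have to be interpreted alike in order that the world referred to
by `o` is the same. -/
def Sig.locSym (Δ : Sig.{u}) : Option Δ.Nom → Set Δ.Sym
  | none => ∅
  | some k => {.inl k}

theorem Sig.locSym_finite (o : Option Δ.Nom) : (Δ.locSym o).Finite := by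
  cases o with
  | none => exact Set.finite_empty
  | some k => exact Set.finite_singleton _

theorem Kripke.worldOf_upd {M : Kripke Δ} {f : Δ.Nom → N}
    {g : ∀ {n : ℕ} {ar : Fin n → Δ.RS} {s : Δ.RS},
      Δ.RF n ar s → G n ar s ⊕ Term (Δ.upd N G) (.rig s)}
    {nm : N → M.W}
    {rf : ∀ {n : ℕ} {ar : Fin n → Δ.RS} {s : Δ.RS}, G n ar s → (∀ i, M.R (ar i)) → M.R s}
    (o : Option Δ.Nom) (h : ∀ σ ∈ Δ.locSym o, M.AgreeAt f g nm rf σ) (w : M.W) :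
    (M.upd nm rf).worldOf w (o.map f) = M.worldOf w o := by
  cases o with
  | none => rfl
  | some k => exact h (.inl k) rfl

/-- The value of a term is preserved by translation as soon as finitely many symbols, depending
only on the term, are interpreted alike. The equality is heterogeneous because the carrier of a
sort `@ₖ s` depends on the world named by `k`. -/
theorem Term.exists_finite_support {h : HSort Δ} (t : Term Δ h) :
    ∃ K : Set Δ.Sym, K.Finite ∧
      ∀ (N : Type u) (G : (n : ℕ) → (Fin n → Δ.RS) → Δ.RS → Type u) (f : Δ.Nom → N)
        (g : ∀ {n : ℕ} {ar : Fin n → Δ.RS} {s : Δ.RS},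
          Δ.RF n ar s → G n ar s ⊕ Term (Δ.upd N G) (.rig s))
        (M : Kripke Δ) (nm : N → M.W)
        (rf : ∀ {n : ℕ} {ar : Fin n → Δ.RS} {s : Δ.RS}, G n ar s → (∀ i, M.R (ar i)) → M.R s),
        (∀ σ ∈ K, M.AgreeAt f g nm rf σ) →
          ∀ w, HEq ((M.upd nm rf).eval w (t.tr (Trans.upd f g))) (M.eval w t) := by
  induction t with
  | @rig n ar s σ args ih =>
    choose K hK H using ih
    refine ⟨{.inr ⟨n, ar, s, σ⟩} ∪ ⋃ i, K i,
      (Set.finite_singleton _).union (Set.finite_iUnion hK), ?_⟩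
    intro N G f g M nm rf hag w
    have h1 := hag _ (Or.inl rfl) w (fun i => M.eval w (args i))
    have h2 : ∀ i, (M.upd nm rf).eval w ((args i).tr (Trans.upd f g)) = M.eval w (args i) :=
      fun i => eq_of_heq (H i N G f g M nm rf
        (fun σ hσ => hag σ (Or.inr (Set.mem_iUnion.2 ⟨i, hσ⟩))) w)
    apply heq_of_eq
    refine Eq.trans ?_ h1
    simp only [Term.tr]
    cases hg : g σ with
    | inl σ' =>
      change rf σ' (fun i => (M.upd nm rf).eval w ((args i).tr (Trans.upd f g))) = rf σ' _
      rw [funext h2]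
    | inr t => rfl
  | @flex o n ar s σ args ih =>
    choose K hK H using ih
    refine ⟨Δ.locSym o ∪ ⋃ i, K i, (Sig.locSym_finite o).union (Set.finite_iUnion hK), ?_⟩
    intro N G f g M nm rf hag w
    have hw := Kripke.worldOf_upd (f := f) (g := g) (rf := rf) o
      (fun σ hσ => hag σ (Or.inl hσ)) w
    simp only [Term.tr]
    refine (Kripke.eval_transport _ _ _ _).trans ?_
    refine (Kripke.toLoc_heq _ _ _ _ _).trans (HEq.trans ?_ (Kripke.toLoc_heq M w o s _).symm)
    refine Kripke.ff_heq M σ hw fun i => ?_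
    refine (Kripke.ofLoc_heq _ _ _ _ _).trans (HEq.trans ?_ (Kripke.ofLoc_heq M w o _ _).symm)
    exact (Kripke.eval_transport _ _ _ _).trans (H i N G f g M nm rf
      (fun σ hσ => hag σ (Or.inr (Set.mem_iUnion.2 ⟨i, hσ⟩))) w)

theorem Act.map_id {Λ : Type u} (a : Act Λ) : a.map (fun l => l) = a := by
  induction a <;> simp_all [Act.map]

theorem Kripke.acc_upd (M : Kripke Δ) (nm : N → M.W)
    (rf : ∀ {n : ℕ} {ar : Fin n → Δ.RS} {s : Δ.RS}, G n ar s → (∀ i, M.R (ar i)) → M.R s)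
    (a : Act Δ.Mod) : (M.upd nm rf).acc a = M.acc a := by
  induction a with
  | atom l => rfl
  | seq a b iha ihb => simp only [Kripke.acc, iha, ihb]
  | union a b iha ihb => simp only [Kripke.acc, iha, ihb]
  | star a ih => simp only [Kripke.acc, ih]

/-- The value of a term of `Δ` in an expansion to `Δ[C]` is its value in `Δ`. -/
theorem Kripke.eval_tr_incl (M : Kripke Δ) {C : Δ.ESrt → Type u}
    (v : ∀ e, C e → M.ECarrier e) (w : M.W) {h : HSort Δ} (t : Term Δ h) :
    HEq ((M.expand v).eval w (t.tr (Hom.incl Δ C).toTrans)) (M.eval w t) := by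
  obtain ⟨K, -, H⟩ := t.exists_finite_support
  refine H (Δ.Nom ⊕ C none) (Δ.AddFn C) Sum.inl (fun σ => .inl (.old σ)) M
    (M.expand v).nom (M.expand v).rf (fun σ _ => ?_) w
  rcases σ with k | ⟨_, _, _, σ⟩
  · rfl
  · intro w args; rfl

theorem Kripke.eval_tr_incl_rig (M : Kripke Δ) {C : Δ.ESrt → Type u}
    (v : ∀ e, C e → M.ECarrier e) (w : M.W) {s : Δ.RS} (t : Term Δ (.rig s)) :
    (M.expand v).eval w (t.tr (Hom.incl Δ C).toTrans) = M.eval w t :=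
  eq_of_heq (M.eval_tr_incl v w t)

/-- The symbols of `Δ` as symbols of `Δ[C]`. -/
def Sig.symIncl (Δ : Sig.{u}) (C : Δ.ESrt → Type u) : Δ.Sym → (Δ.add C).Sym
  | .inl k => .inl (.inl k)
  | .inr ⟨n, ar, s, σ⟩ => .inr ⟨n, ar, s, .old σ⟩

theorem Sig.symIncl_injective (Δ : Sig.{u}) (C : Δ.ESrt → Type u) :
    Function.Injective (Δ.symIncl C) := by
  rintro (k | ⟨n, ar, s, σ⟩) (k' | ⟨n', ar', s', σ'⟩) h
  · simpa [Sig.symIncl] using h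
  · simp [Sig.symIncl] at h
  · simp [Sig.symIncl] at h
  · simp only [Sig.symIncl, Sum.inr.injEq, Sigma.mk.injEq] at h
    obtain ⟨rfl, h⟩ := h
    obtain ⟨rfl, h⟩ := Sigma.mk.inj_iff.1 (eq_of_heq h)
    obtain ⟨rfl, h⟩ := Sigma.mk.inj_iff.1 (eq_of_heq h)
    cases eq_of_heq h
    rfl

/-- Agreement on symbols is inherited by the extensions under quantifiers. -/
theorem Kripke.AgreeAt.lift {M : Kripke Δ} {f : Δ.Nom → N}
    {g : ∀ {n : ℕ} {ar : Fin n → Δ.RS} {s : Δ.RS},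
      Δ.RF n ar s → G n ar s ⊕ Term (Δ.upd N G) (.rig s)}
    {nm : N → M.W}
    {rf : ∀ {n : ℕ} {ar : Fin n → Δ.RS} {s : Δ.RS}, G n ar s → (∀ i, M.R (ar i)) → M.R s}
    {n : ℕ} (X : Fin n → Δ.ESrt)
    (v : ∀ e, Δ.vars X e → M.ECarrier e)
    (v' : ∀ e, (Δ.upd N G).vars (fun i => (X i).map fun s => s) e → (M.upd nm rf).ECarrier e)
    (hv : ∀ e (i : Fin n) (h : X i = e) (h' : (X i).map (fun s => s) = e),
      HEq (v' e ⟨i, h'⟩) (v e ⟨i, h⟩))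
    (σ : (Δ.addVars X).Sym)
    (hσ : ∀ τ, Δ.symIncl (Δ.vars X) τ = σ → M.AgreeAt f g nm rf τ) :
    (M.expand v).AgreeAt ((Trans.upd f g).lift X).nom ((Trans.upd f g).lift X).rf
      ((M.upd nm rf).expand v').nom ((M.upd nm rf).expand v').rf σ := by
  match σ, hσ with
  | .inl (.inl k), hσ => exact hσ (.inl k) rfl
  | .inl (.inr ⟨i, hi⟩), _ => exact eq_of_heq (hv _ _ hi _)
  | .inr ⟨n, ar, s, .old σ⟩, hσ =>
    have h := hσ (.inr ⟨n, ar, s, σ⟩) rfl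
    intro w args
    refine Eq.trans ?_ (h w args)
    simp only [Trans.lift]
    cases hg : g σ with
    | inl σ' => rfl
    | inr t => exact Kripke.eval_tr_incl_rig (M.upd nm rf) v' w t
  | .inr ⟨_, _, _, .new c⟩, _ =>
    intro w args
    exact eq_of_heq (hv _ c.down.1 c.down.2 _)

end

theorem Sen.sat_store {Δ : Sig.{u}} (γ : Sen Δ.addNom) (M : Kripke Δ) (w : M.W)
    (v : ∀ e, Δ.vars (fun _ : Fin 1 => none) e → M.ECarrier e) (hv : ∀ z, v none z = w) :
    (Sen.store γ).Sat M w ↔ γ.Sat (M.expand v) w := by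
  rw [Sen.Sat]
  congr! 2
  funext e z
  cases e with
  | none => exact (hv z).symm
  | some s => exact nomatch z.down.2

/-- Coincidence lemma and satisfaction condition in one: whether a sentence holds is preserved by
translation as soon as finitely many symbols, depending only on the sentence, are interpreted
alike. -/
theorem Sen.exists_finite_support {Δ : Sig.{u}} (γ : Sen Δ) :
    ∃ K : Set Δ.Sym, K.Finite ∧
      ∀ (N : Type u) (G : (n : ℕ) → (Fin n → Δ.RS) → Δ.RS → Type u) (f : Δ.Nom → N)
        (g : ∀ {n : ℕ} {ar : Fin n → Δ.RS} {s : Δ.RS},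
          Δ.RF n ar s → G n ar s ⊕ Term (Δ.upd N G) (.rig s))
        (M : Kripke Δ) (nm : N → M.W)
        (rf : ∀ {n : ℕ} {ar : Fin n → Δ.RS} {s : Δ.RS}, G n ar s → (∀ i, M.R (ar i)) → M.R s),
        (∀ σ ∈ K, M.AgreeAt f g nm rf σ) →
          ∀ w, (γ.tr (Trans.upd f g)).Sat (M.upd nm rf) w ↔ γ.Sat M w := by
  induction γ with
  | nom k =>
    refine ⟨{.inl k}, Set.finite_singleton _, ?_⟩
    intro N G f g M nm rf hag w
    have h : nm (f k) = M.nom k := hag (.inl k) rfl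
    change nm (f k) = w ↔ M.nom k = w
    rw [h]
  | @eq Δ h t₁ t₂ =>
    obtain ⟨K₁, hK₁, H₁⟩ := t₁.exists_finite_support
    obtain ⟨K₂, hK₂, H₂⟩ := t₂.exists_finite_support
    -- The world that a flexible sort refers to must agree for the two carriers to be the same.
    let o : Option Δ.Nom := match h with
      | .rig _ => none
      | .flex o _ => o
    refine ⟨Δ.locSym o ∪ (K₁ ∪ K₂), (Sig.locSym_finite o).union (hK₁.union hK₂), ?_⟩
    intro N G f g M nm rf hag w
    refine eq_iff_of_heq ?_ (H₁ N G f g M nm rf (fun σ hσ => hag σ (.inr (.inl hσ))) w)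
      (H₂ N G f g M nm rf (fun σ hσ => hag σ (.inr (.inr hσ))) w)
    have hw := Kripke.worldOf_upd (f := f) (g := g) (rf := rf) o
      (fun σ hσ => hag σ (Or.inl hσ)) w
    cases h with
    | rig s => rfl
    | flex o s => exact congrArg (fun v => M.F v s) hw
  | rrel π t =>
    choose K hK H using fun i => (t i).exists_finite_support
    refine ⟨⋃ i, K i, Set.finite_iUnion hK, ?_⟩
    intro N G f g M nm rf hag w
    refine iff_of_eq (congrArg (M.rp π) (funext fun i => ?_))
    exact eq_of_heq (H i N G f g M nm rf (fun σ hσ => hag σ (Set.mem_iUnion.2 ⟨i, hσ⟩)) w)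
  | @frel Δ o n ar π t =>
    choose K hK H using fun i => (t i).exists_finite_support
    refine ⟨Δ.locSym o ∪ ⋃ i, K i, (Sig.locSym_finite o).union (Set.finite_iUnion hK), ?_⟩
    intro N G f g M nm rf hag w
    have hw := Kripke.worldOf_upd (f := f) (g := g) (rf := rf) o
      (fun σ hσ => hag σ (Or.inl hσ)) w
    refine Kripke.fp_iff M π hw fun i => ?_
    refine (Kripke.ofLoc_heq _ _ _ _ _).trans (HEq.trans ?_ (Kripke.ofLoc_heq M w o _ _).symm)
    exact (Kripke.eval_transport _ _ _ _).trans (H i N G f g M nm rf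
      (fun σ hσ => hag σ (Or.inr (Set.mem_iUnion.2 ⟨i, hσ⟩))) w)
  | ret k γ ih =>
    obtain ⟨K, hK, H⟩ := ih
    refine ⟨{.inl k} ∪ K, (Set.finite_singleton _).union hK, ?_⟩
    intro N G f g M nm rf hag w
    have h : nm (f k) = M.nom k := hag (.inl k) (.inl rfl)
    have := H N G f g M nm rf (fun σ hσ => hag σ (.inr hσ)) (M.nom k)
    rw [← h] at this
    change (γ.tr (Trans.upd f g)).Sat (M.upd nm rf) (nm (f k)) ↔ γ.Sat M (M.nom k)
    rw [this, h]
  | neg γ ih =>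
    obtain ⟨K, hK, H⟩ := ih
    exact ⟨K, hK, fun N G f g M nm rf hag w => not_congr (H N G f g M nm rf hag w)⟩
  | disj Γ ih =>
    choose K hK H using ih
    refine ⟨⋃ i, K i, Set.finite_iUnion hK, ?_⟩
    intro N G f g M nm rf hag w
    exact exists_congr fun i =>
      H i N G f g M nm rf (fun σ hσ => hag σ (Set.mem_iUnion.2 ⟨i, hσ⟩)) w
  | @store Δ γ ih =>
    obtain ⟨K, hK, H⟩ := ih
    refine ⟨Δ.symIncl _ ⁻¹' K, hK.preimage (Δ.symIncl_injective _).injOn, ?_⟩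
    intro N G f g M nm rf hag w
    let v : ∀ e, Δ.vars (fun _ : Fin 1 => none) e → M.ECarrier e := fun e z => match e, z with
      | none, _ => w
      | some _, z => nomatch z.down.2
    let v' : ∀ e, (Δ.upd N G).vars (fun _ : Fin 1 => none) e → (M.upd nm rf).ECarrier e :=
      fun e z => match e, z with
      | none, _ => w
      | some _, z => nomatch z.down.2
    refine (Sen.sat_store _ (M.upd nm rf) w v' fun _ => rfl).trans
      (Iff.trans ?_ (Sen.sat_store γ M w v fun _ => rfl).symm)
    refine H _ _ ((Trans.upd f g).lift _).nom ((Trans.upd f g).lift _).rf (M.expand v)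
      ((M.upd nm rf).expand v').nom ((M.upd nm rf).expand v').rf ?_ w
    intro σ hσ
    refine Kripke.AgreeAt.lift (fun _ : Fin 1 => none) v v' ?_ σ
      (fun τ hτ => hag τ (by rw [Set.mem_preimage, hτ]; exact hσ))
    intro e i h h'
    cases e with
    | none => rfl
    | some s => cases h
  | @ex Δ n X γ ih =>
    obtain ⟨K, hK, H⟩ := ih
    refine ⟨Δ.symIncl _ ⁻¹' K, hK.preimage (Δ.symIncl_injective _).injOn, ?_⟩
    intro N G f g M nm rf hag w
    have key : ∀ (v : ∀ e, Δ.vars X e → M.ECarrier e)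
        (v' : ∀ e, (Δ.upd N G).vars (fun i => (X i).map fun s => s) e →
          (M.upd nm rf).ECarrier e),
        (∀ e (i : Fin n) (h : X i = e) (h' : (X i).map (fun s => s) = e),
          HEq (v' e ⟨i, h'⟩) (v e ⟨i, h⟩)) →
        ((γ.tr ((Trans.upd f g).lift X)).Sat ((M.upd nm rf).expand v') w ↔
          γ.Sat (M.expand v) w) := by
      intro v v' hv
      refine H _ _ ((Trans.upd f g).lift X).nom ((Trans.upd f g).lift X).rf (M.expand v) _ _ ?_ w
      intro σ hσ
      exact Kripke.AgreeAt.lift X _ _ hv σ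
        (fun τ hτ => hag τ (by rw [Set.mem_preimage, hτ]; exact hσ))
    have hX : ∀ i, (X i).map (fun s => s) = X i := fun i => by cases X i <;> rfl
    have hc : ∀ e, (M.upd nm rf).ECarrier e = M.ECarrier e := fun e => by cases e <;> rfl
    constructor
    · rintro ⟨v', h⟩
      refine ⟨fun e z => cast (hc e) (v' e ⟨z.down.1, (hX _).trans z.down.2⟩),
        (key _ v' ?_).1 h⟩
      intro e i h h'
      exact (cast_heq _ _).symm
    · rintro ⟨v, h⟩
      refine ⟨fun e z => cast (hc e).symm (v e ⟨z.down.1, (hX _).symm.trans z.down.2⟩),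
        (key v _ ?_).2 h⟩
      intro e i h h'
      exact cast_heq _ _
  | dia a γ ih =>
    obtain ⟨K, hK, H⟩ := ih
    refine ⟨K, hK, fun N G f g M nm rf hag w => ?_⟩
    have := H N G f g M nm rf hag
    change (∃ w', (M.upd nm rf).acc (a.map fun l => l) w w' ∧ _) ↔ _
    rw [Act.map_id, Kripke.acc_upd]
    exact exists_congr fun w' => and_congr Iff.rfl (this w')

/-! ### Expansions by constants -/

section

variable {Δ : Sig.{u}} {C X : Δ.ESrt → Type u}

/-- The elements of an extended rigid sort of `M` as elements of an expansion of `M`. -/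
def Kripke.toExpand (M : Kripke Δ) (v : ∀ e, C e → M.ECarrier e) :
    (e : Δ.ESrt) → M.ECarrier e → (M.expand v).ECarrier e
  | none, x => x
  | some _, x => x

theorem Kripke.toExpand_bijective (M : Kripke Δ) (v : ∀ e, C e → M.ECarrier e) (e : Δ.ESrt) :
    Function.Bijective (M.toExpand v e) := by
  cases e <;> exact Function.bijective_id

/-- The expansion of `M` to `Δ[C][X]` that interprets `C` by `u` and `X` by `v`. -/
abbrev Kripke.expand₂ (M : Kripke Δ) (u : ∀ e, C e → M.ECarrier e)
    (v : ∀ e, X e → M.ECarrier e) : Kripke ((Δ.add C).add X) :=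
  (M.expand u).expand (fun e x => M.toExpand u e (v e x))

theorem Kripke.exists_eq_expand (M : Kripke (Δ.add C)) :
    ∃ (M₀ : Kripke Δ) (v : ∀ e, C e → M₀.ECarrier e), M = M₀.expand v := by
  rcases M with ⟨W, hW, R, hR, F, hF, nom, mod, rf, ff, rp, fp⟩
  let M₀ : Kripke Δ :=
    ⟨W, hW, R, hR, F, hF, fun k => nom (.inl k), mod, fun σ => rf (.old σ), ff, rp, fp⟩
  let v : ∀ e, C e → M₀.ECarrier e := fun e c => match e, c with
    | none, c => nom (.inr c)
    | some s, c => rf (.new (ar := fun i => i.elim0) c) (fun i => i.elim0)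
  refine ⟨M₀, v, ?_⟩
  have h₁ : nom = (M₀.expand v).nom := by
    funext k; cases k <;> rfl
  have h₂ : @rf = fun (n : ℕ) (ar : Fin n → Δ.RS) (s : Δ.RS) (σ : Δ.AddFn C n ar s) =>
      (M₀.expand v).rf σ := by
    funext n ar s
    refine funext fun σ : Δ.AddFn C n ar s => ?_
    exact match ar, σ with
    | _, .old σ => rfl
    | ar, .new c => by
      funext args
      obtain rfl : ar = fun i => i.elim0 := Subsingleton.elim _ _
      exact congrArg _ (funext fun i => i.elim0)
  exact congrArg₂ (fun (nom : (Δ.add C).Nom → W)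
    (rf : ∀ (n : ℕ) (ar : Fin n → Δ.RS) (s : Δ.RS), Δ.AddFn C n ar s →
      (∀ i, R (ar i)) → R s) =>
    (⟨W, hW, R, hR, F, hF, nom, mod, fun {n ar s} => rf n ar s, ff, rp, fp⟩ : Kripke (Δ.add C)))
    h₁ h₂

theorem Kripke.exists_eq_expand₂ (M : Kripke ((Δ.add C).add X)) :
    ∃ (M₀ : Kripke Δ) (u : ∀ e, C e → M₀.ECarrier e) (v : ∀ e, X e → M₀.ECarrier e),
      M = M₀.expand₂ u v := by
  obtain ⟨M₁, v, rfl⟩ := M.exists_eq_expand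
  obtain ⟨M₀, u, rfl⟩ := M₁.exists_eq_expand
  choose g hg using fun e => (M₀.toExpand_bijective u e).2
  refine ⟨M₀, u, fun e x => g e (v e x), ?_⟩
  congr 1
  funext e x
  exact (hg e _).symm

theorem Sen.sat_tr_incl (γ : Sen Δ) (M : Kripke Δ) (v : ∀ e, C e → M.ECarrier e) (w : M.W) :
    (γ.tr (Hom.incl Δ C).toTrans).Sat (M.expand v) w ↔ γ.Sat M w := by
  obtain ⟨K, -, H⟩ := γ.exists_finite_support
  refine H (Δ.Nom ⊕ C none) (Δ.AddFn C) Sum.inl (fun σ => .inl (.old σ)) M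
    (M.expand v).nom (M.expand v).rf (fun σ _ => ?_) w
  rcases σ with k | ⟨_, _, _, σ⟩
  · rfl
  · intro w args; rfl

theorem Kripke.models_image_incl (M : Kripke Δ) (v : ∀ e, C e → M.ECarrier e) (T : Set (Sen Δ)) :
    (M.expand v).Models ((fun γ => γ.tr (Hom.incl Δ C).toTrans) '' T) ↔ M.Models T := by
  unfold Kripke.Models
  rw [Set.forall_mem_image]
  exact forall₂_congr fun γ _ => forall_congr' fun w => γ.sat_tr_incl M v w

/-- Rigid terms have the same value in all worlds. -/
theorem Term.IsRigid.eval_heq {M : Kripke Δ} {h : HSort Δ} {t : Term Δ h} (ht : t.IsRigid)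
    (w w' : M.W) : HEq (M.eval w t) (M.eval w' t) := by
  induction t with
  | rig σ args ih =>
    exact heq_of_eq (congrArg (M.rf σ) (funext fun i => eq_of_heq (ih i (ht i))))
  | @flex o n ar s σ args ih =>
    obtain ⟨ho, ht⟩ := ht
    obtain ⟨k, rfl⟩ := Option.isSome_iff_exists.1 ho
    refine (M.toLoc_heq _ _ _ _).trans (HEq.trans ?_ (M.toLoc_heq w' _ s _).symm)
    refine M.ff_heq σ rfl fun i => ?_
    exact (M.ofLoc_heq _ _ _ _).trans ((ih i (ht i)).trans (M.ofLoc_heq w' _ _ _).symm)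

/-- The value of a constant in `X` under a substitution `θ : X → C`. For a rigid sort the term is
evaluated in an arbitrary world, on which its value does not depend. -/
noncomputable def Subst.val {C₁ C₂ : Δ.ESrt → Type u} (θ : Subst Δ C₁ C₂) (M : Kripke Δ)
    (v : ∀ e, C₂ e → M.ECarrier e) : ∀ e, C₁ e → M.ECarrier e
  | none, x => (M.expand v).nom (θ.nom x)
  | some s, x => (M.expand v).eval (h := .rig s) (Classical.choice M.W_nonempty) (θ.con s x).1

theorem Sen.sat_tr_subst {C₁ C₂ : Δ.ESrt → Type u} (θ : Subst Δ C₁ C₂) (γ : Sen (Δ.add C₁))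
    (M : Kripke Δ) (v : ∀ e, C₂ e → M.ECarrier e) (w : M.W) :
    (γ.tr θ.toTrans).Sat (M.expand v) w ↔ γ.Sat (M.expand (θ.val M v)) w := by
  obtain ⟨K, -, H⟩ := γ.exists_finite_support
  refine H (Δ.Nom ⊕ C₂ none) (Δ.AddFn C₂) θ.toTrans.nom θ.toTrans.rf (M.expand (θ.val M v))
    (M.expand v).nom (M.expand v).rf (fun σ _ => ?_) w
  match σ with
  | .inl (.inl k) => rfl
  | .inl (.inr x) => rfl
  | .inr ⟨_, _, _, .old σ⟩ => intro w args; rfl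
  | .inr ⟨_, _, _, .new c⟩ =>
    intro w args
    exact eq_of_heq ((θ.con _ c).2.eval_heq (M := M.expand v) w _)

/-- The elements of `C` as symbols of `Δ[C][X]`. -/
def Sig.cstSym (Δ : Sig.{u}) (C : Δ.ESrt → Type u) (X : Δ.ESrt → Type u) :
    (Σ e, C e) → ((Δ.add C).add X).Sym
  | ⟨none, c⟩ => .inl (.inl (.inr c))
  | ⟨some s, c⟩ => .inr ⟨0, fun i => i.elim0, s, .old (.new c)⟩

theorem Sig.cstSym_injective : Function.Injective (Δ.cstSym C X) := by
  rintro ⟨_ | s, c⟩ ⟨_ | s', c'⟩ h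
  · simpa [Sig.cstSym] using h
  · simp [Sig.cstSym] at h
  · simp [Sig.cstSym] at h
  · simp only [Sig.cstSym, Sum.inr.injEq, Sigma.mk.injEq, heq_eq_eq, true_and] at h
    obtain ⟨rfl, h⟩ := h
    cases eq_of_heq h
    rfl

theorem Kripke.expand₂_agreeAt {M : Kripke Δ} {u u' : ∀ e, C e → M.ECarrier e}
    {v : ∀ e, X e → M.ECarrier e} (σ : ((Δ.add C).add X).Sym)
    (h : ∀ c, Δ.cstSym C X c = σ → u c.1 c.2 = u' c.1 c.2) :
    (M.expand₂ u' v).AgreeAt (fun k => k) (fun σ => .inl σ) (M.expand₂ u v).nom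
      (M.expand₂ u v).rf σ := by
  match σ, h with
  | .inl (.inl (.inl k)), _ => rfl
  | .inl (.inl (.inr c)), h => exact h ⟨none, c⟩ rfl
  | .inl (.inr x), _ => rfl
  | .inr ⟨_, _, _, .old (.old σ)⟩, _ => intro w args; rfl
  | .inr ⟨_, ar, _, .old (.new c)⟩, h =>
    intro w args
    exact h ⟨some _, c⟩ (by
      obtain rfl : ar = fun i => i.elim0 := Subsingleton.elim _ _
      rfl)
  | .inr ⟨_, _, _, .new x⟩, _ => intro w args; rfl

/-- A sentence of `Δ[C][X]` depends on finitely many constants in `C`. -/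
theorem Sen.exists_finite_constants (γ : Sen ((Δ.add C).add X)) :
    ∃ K : Set (Σ e, C e), K.Finite ∧
      ∀ (M : Kripke Δ) (u u' : ∀ e, C e → M.ECarrier e) (v : ∀ e, X e → M.ECarrier e),
        (∀ c ∈ K, u c.1 c.2 = u' c.1 c.2) →
          ∀ w : M.W, γ.Sat (M.expand₂ u v) w ↔ γ.Sat (M.expand₂ u' v) w := by
  obtain ⟨K, hK, H⟩ := γ.exists_finite_support
  refine ⟨Δ.cstSym C X ⁻¹' K, hK.preimage Sig.cstSym_injective.injOn, ?_⟩
  intro M u u' v h w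
  have h₁ := H _ _ (fun k => k) (fun σ => .inl σ) (M.expand₂ u v) (M.expand₂ u v).nom
    (M.expand₂ u v).rf (fun σ _ => Kripke.expand₂_agreeAt σ fun _ _ => rfl) w
  have h₂ := H _ _ (fun k => k) (fun σ => .inl σ) (M.expand₂ u' v) (M.expand₂ u v).nom
    (M.expand₂ u v).rf (fun σ hσ => Kripke.expand₂_agreeAt σ fun c hc => h c (by
      rw [Set.mem_preimage, hc]; exact hσ)) w
  exact h₁.symm.trans h₂

/-- The value of a variable under a substitution over `Δ[C]`. -/
noncomputable def Subst.val₂ {C' : Δ.ESrt → Type u} (θ : Subst (Δ.add C) X C') (M : Kripke Δ)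
    (u : ∀ e, C e → M.ECarrier e) (v : ∀ e, C' e → M.ECarrier e) : ∀ e, X e → M.ECarrier e
  | none, x => (M.expand₂ u v).nom (θ.nom x)
  | some s, x => (M.expand₂ u v).eval (h := .rig s) (Classical.choice M.W_nonempty) (θ.con s x).1

theorem Sen.sat_tr_subst₂ {C' : Δ.ESrt → Type u} (θ : Subst (Δ.add C) X C')
    (γ : Sen ((Δ.add C).add X)) (M : Kripke Δ) (u : ∀ e, C e → M.ECarrier e)
    (v : ∀ e, C' e → M.ECarrier e) (w : M.W) :
    (γ.tr θ.toTrans).Sat (M.expand₂ u v) w ↔ γ.Sat (M.expand₂ u (θ.val₂ M u v)) w := by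
  have h : (fun e x => M.toExpand u e (θ.val₂ M u v e x)) =
      θ.val (M.expand u) (fun e x => M.toExpand u e (v e x)) := by
    funext e x
    cases e <;> rfl
  exact (γ.sat_tr_subst θ (M.expand u) _ w).trans (by rw [← h])

theorem Subst.exists_finite_constants {C' : Δ.ESrt → Type u} (θ : Subst (Δ.add C) X C')
    (e : Δ.ESrt) (x : X e) :
    ∃ K : Set (Σ e, C e), K.Finite ∧
      ∀ (M : Kripke Δ) (u u' : ∀ e, C e → M.ECarrier e) (v : ∀ e, C' e → M.ECarrier e),
        (∀ c ∈ K, u c.1 c.2 = u' c.1 c.2) → θ.val₂ M u v e x = θ.val₂ M u' v e x := by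
  cases e with
  | none =>
    refine ⟨Δ.cstSym C C' ⁻¹' {.inl (θ.nom x)},
      (Set.finite_singleton _).preimage Sig.cstSym_injective.injOn, ?_⟩
    intro M u u' v h
    exact Kripke.expand₂_agreeAt (.inl (θ.nom x)) h
  | some s =>
    obtain ⟨K, hK, H⟩ := (θ.con s x).1.exists_finite_support
    refine ⟨Δ.cstSym C C' ⁻¹' K, hK.preimage Sig.cstSym_injective.injOn, ?_⟩
    intro M u u' v h
    have h₁ := H _ _ (fun k => k) (fun σ => .inl σ) (M.expand₂ u v) (M.expand₂ u v).nom
      (M.expand₂ u v).rf (fun σ _ => Kripke.expand₂_agreeAt σ fun _ _ => rfl)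
      (Classical.choice M.W_nonempty)
    have h₂ := H _ _ (fun k => k) (fun σ => .inl σ) (M.expand₂ u' v) (M.expand₂ u v).nom
      (M.expand₂ u v).rf (fun σ hσ => Kripke.expand₂_agreeAt σ fun c hc => h c (by
        rw [Set.mem_preimage, hc]; exact hσ)) (Classical.choice M.W_nonempty)
    exact eq_of_heq (h₁.symm.trans h₂)

end

/-! ### Admissible interpretations of the new constants -/

/-- The new constants of each sort. The `a n` are infinitely many distinct elements; together with
the `b j` they name all elements; the `k` with `c k = a 0` form a subset of `A`; and `d i` tells
below which point that subset is bounded in the initial segment given by `i`. -/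
inductive Cst (A : Type u) : Type u
  | a (n : ℕ)
  | b (j : A)
  | c (k : A)
  | d (i : A)

/-- The index of a constant. -/
def Cst.index {A : Type u} : Cst A → Option A
  | .a _ => none
  | .b j => some j
  | .c k => some k
  | .d i => some i

section

variable {A : Type u} [LinearOrder A]

/-- The sequence `s` is cofinal in the initial segment below `i`. -/
def IsLadder (i : A) (s : ℕ → A) : Prop := (∀ n, s n < i) ∧ ∀ k < i, ∃ n, k < s n

/-- The quadruples of constants whose values `x`, `y`, `z`, `t` must not satisfy `x = y` and
`z = t`. -/
inductive Forbidden (l : A → ℕ → A) : Cst A → Cst A → Cst A → Cst A → Prop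
  | aa (n m : ℕ) (h : n ≠ m) : Forbidden l (.a n) (.a m) (.a n) (.a m)
  | ab (n : ℕ) (j : A) : Forbidden l (.a n) (.b j) (.a n) (.b j)
  | da (i k : A) (n : ℕ) (hi : IsLadder i (l i)) (h : l i n < k) (h' : k < i) :
      Forbidden l (.d i) (.a n) (.c k) (.a 0)
  | db (i j k : A) (h : j < k) (h' : k < i) : Forbidden l (.d i) (.b j) (.c k) (.a 0)

/-- An interpretation of the constants that respects all the prohibitions. -/
def Admissible {B : Type u} (l : A → ℕ → A) (u : Cst A → B) : Prop :=
  ∀ x y z t, Forbidden l x y z t → ¬ (u x = u y ∧ u z = u t)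

theorem admissible_iff {B : Type u} {l : A → ℕ → A} {u : Cst A → B} :
    Admissible l u ↔ (∀ n m, n ≠ m → u (.a n) ≠ u (.a m)) ∧ (∀ n j, u (.a n) ≠ u (.b j)) ∧
      (∀ i k n, IsLadder i (l i) → l i n < k → k < i → u (.d i) = u (.a n) →
        u (.c k) ≠ u (.a 0)) ∧
      (∀ i j k, j < k → k < i → u (.d i) = u (.b j) → u (.c k) ≠ u (.a 0)) := by
  constructor
  · intro h
    exact ⟨fun n m hnm e => h _ _ _ _ (.aa n m hnm) ⟨e, e⟩,
      fun n j e => h _ _ _ _ (.ab n j) ⟨e, e⟩,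
      fun i k n hi h₁ h₂ e e' => h _ _ _ _ (.da i k n hi h₁ h₂) ⟨e, e'⟩,
      fun i j k h₁ h₂ e e' => h _ _ _ _ (.db i j k h₁ h₂) ⟨e, e'⟩⟩
  · rintro ⟨h₁, h₂, h₃, h₄⟩ _ _ _ _ hf ⟨e, e'⟩
    cases hf with
    | aa n m h => exact h₁ n m h e
    | ab n j => exact h₂ n j e
    | da i k n hi h h' => exact h₃ i k n hi h h' e e'
    | db i j k h h' => exact h₄ i j k h h' e e'

theorem exists_admissible {B : Type u} [Infinite B] (l : A → ℕ → A) :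
    ∃ u : Cst A → B, Admissible l u := by
  let g := Infinite.natEmbedding B
  refine ⟨fun c => match c with
    | .a n => g (n + 1)
    | .b _ => g 0
    | .c _ => g 0
    | .d _ => g 0, admissible_iff.2 ⟨?_, ?_, ?_, ?_⟩⟩
  · intro n m h e; exact h (by simpa using g.injective e)
  · intro n j e; simpa using g.injective e
  · intro i k n _ _ _ _ e; simpa using g.injective e
  · intro i j k _ _ _ e; simpa using g.injective e

open Classical in
/-- An admissible interpretation can be changed from the index `β` on: the value of `b β` may be
any element other than the `a n`, and that of `c β` may be arbitrary. -/
theorem Admissible.exists_modification {B : Type u} {l : A → ℕ → A} {u : Cst A → B}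
    (hu : Admissible l u) (β : A) (x y : B) (hx : ∀ n, u (.a n) ≠ x) :
    ∃ u' : Cst A → B, Admissible l u' ∧ u' (.b β) = x ∧ u' (.c β) = y ∧
      ∀ c : Cst A, (∀ i ∈ c.index, i < β) → u' c = u c := by
  obtain ⟨h₁, h₂, h₃, h₄⟩ := admissible_iff.1 hu
  have hn : ∀ i, ∃ n, IsLadder i (l i) → β < i → β < l i n := fun i => by
    by_cases h : IsLadder i (l i) ∧ β < i
    · obtain ⟨n, hn⟩ := h.1.2 β h.2
      exact ⟨n, fun _ _ => hn⟩
    · exact ⟨0, fun h₁ h₂ => absurd ⟨h₁, h₂⟩ h⟩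
  choose n hn using hn
  -- Beyond `β` the set coded by `c` is empty, and `d i` points to a rung of the ladder above `β`.
  let u' : Cst A → B := fun c => match c with
    | .a n => u (.a n)
    | .b j => if j = β then x else u (.b j)
    | .c k => if k < β then u (.c k) else if k = β then y else u (.a 1)
    | .d i => if i ≤ β then u (.d i) else u (.a (n i))
  have hb : ∀ n j, u' (.a n) ≠ u' (.b j) := by
    intro n j
    by_cases hj : j = β
    · simpa [u', hj] using hx n
    · simpa [u', hj] using h₂ n j
  refine ⟨u', admissible_iff.2 ⟨h₁, hb, ?_, ?_⟩, by simp [u'], by simp [u'], ?_⟩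
  · intro i k m hi hmk hki e
    rcases le_or_gt i β with hiβ | hiβ
    · simp only [u', hiβ, if_true, hki.trans_le hiβ] at e ⊢
      exact h₃ i k m hi hmk hki e
    · simp only [u', hiβ.not_ge, if_false] at e
      obtain rfl : n i = m := by
        by_contra hne
        exact h₁ _ _ hne e
      have hk : β < k := (hn i hi hiβ).trans hmk
      simp only [u', hk.not_gt, hk.ne', if_false]
      exact h₁ 1 0 one_ne_zero
  · intro i j k hjk hki e
    rcases le_or_gt i β with hiβ | hiβ
    · have hk := hki.trans_le hiβ
      simp only [u', hiβ, if_true, hk, (hjk.trans hk).ne, if_false] at e ⊢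
      exact h₄ i j k hjk hki e
    · have he : u' (.d i) = u' (.a (n i)) := by simp [u', hiβ.not_ge]
      exact absurd (he.symm.trans e) (hb _ _)
  · rintro (m | j | k | i) hc
    · rfl
    · simp [u', (hc j rfl).ne]
    · simp [u', hc k rfl]
    · simp [u', (hc i rfl).le]

theorem exists_ladders : ∃ l : A → ℕ → A, ∀ i, (∃ s, IsLadder i s) → IsLadder i (l i) := by
  classical
  exact ⟨fun i => if h : ∃ s, IsLadder i s then h.choose else fun _ => i,
    fun i h => by simp only [dif_pos h]; exact h.choose_spec⟩

theorem exists_gt_of_mk_lt_cof {s : Set A} (h : Cardinal.mk s < Order.cof A) :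
    ∃ β, ∀ i ∈ s, i < β :=
  not_isCofinal_iff.1 fun hs => (Order.cof_le hs).not_gt h

/-- If all elements are named and the coded set is unbounded, there are many elements. Otherwise
all names would occur below some `β`; taking the supremum `i` of the first `ω` elements above `β`
of the coded set, whatever `d i` is would bound the set strictly below `i`. -/
theorem Admissible.cof_le_mk [WellFoundedLT A] {B : Type u} {l : A → ℕ → A}
    (hl : ∀ i, (∃ s, IsLadder i s) → IsLadder i (l i)) {u : Cst A → B} (hu : Admissible l u)
    (hA : Cardinal.aleph0 < Order.cof A)
    (hname : ∀ x, (∃ n, u (.a n) = x) ∨ ∃ j, u (.b j) = x)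
    (hunb : ∀ j, ∃ k, j < k ∧ u (.c k) = u (.a 0)) : Order.cof A ≤ Cardinal.mk B := by
  obtain ⟨h₁, h₂, h₃, h₄⟩ := admissible_iff.1 hu
  by_contra! hB
  have : Nonempty A := Order.cof_ne_zero_iff.1 (Cardinal.aleph0_pos.trans hA).ne'
  have hj : ∀ x : B, ∃ j, (∃ n, u (.a n) = x) ∨ u (.b j) = x := fun x => by
    rcases hname x with h | ⟨j, h⟩
    · exact ⟨Classical.arbitrary A, .inl h⟩
    · exact ⟨j, .inr h⟩
  choose j hj using hj
  obtain ⟨β, hβ⟩ := exists_gt_of_mk_lt_cof (Cardinal.mk_range_le.trans_lt hB : _ < Order.cof A)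
    (s := Set.range j)
  choose next hnext hnextC using hunb
  let k : ℕ → A := fun n => Nat.rec (next β) (fun _ x => next x) n
  have hkC : ∀ n, u (.c (k n)) = u (.a 0) := fun n => by cases n <;> exact hnextC _
  have hmono : StrictMono k := strictMono_nat_of_lt_succ fun n => hnext _
  have hkβ : ∀ n, β < k n := fun n => (hnext β).trans_le (hmono.monotone (Nat.zero_le n))
  obtain ⟨i₀, hi₀⟩ := exists_gt_of_mk_lt_cof (s := Set.range k)
    ((Cardinal.le_aleph0_iff_set_countable.2 (Set.countable_range k)).trans_lt hA)
  obtain ⟨i, hi, hmin⟩ := WellFounded.has_min (wellFounded_lt (α := A))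
    {i | ∀ n, k n < i} ⟨i₀, fun n => hi₀ _ ⟨n, rfl⟩⟩
  have hsup : ∀ x < i, ∃ n, x < k n := by
    intro x hx
    by_contra! h
    exact hmin x (fun n => (hmono (Nat.lt_succ_self n)).trans_le (h (n + 1))) hx
  have hlad := hl i ⟨k, hi, hsup⟩
  rcases hj (u (.d i)) with ⟨n, hn⟩ | hb
  · obtain ⟨m, hm⟩ := hsup _ (hlad.1 n)
    exact h₃ i (k m) n hlad hm (hi m) hn.symm (hkC m)
  · exact h₄ i _ (k 0) ((hβ _ ⟨_, rfl⟩).trans (hkβ 0)) (hi 0) hb.symm (hkC 0)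

end

/-! ### Linear orderings of prescribed cofinality -/

theorem exists_linearOrder_cof_eq {B D : Type u} [LinearOrder D] (e : B ≃ D) :
    ∃ _ : LinearOrder B, Order.cof B = Order.cof D :=
  letI : LinearOrder B := LinearOrder.lift' e e.injective
  let f : B ≃o D := { e with map_rel_iff' := Iff.rfl }
  ⟨inferInstance, f.cof_congr⟩

/-- Every set with at least `α` elements carries a linear ordering of cofinality `α`: put a copy of
`α` on top of the set. -/
theorem exists_isLinearOrderOfCof {α : Cardinal.{u}} (hα : α.IsRegular) {B : Type u}
    (hB : α ≤ Cardinal.mk B) : ∃ r : B → B → Prop, IsLinearOrderOfCof r α := by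
  classical
  let A := α.ord.ToType
  have hcard : Cardinal.mk B = Cardinal.mk (B ⊕ₗ A) := by
    have : Cardinal.mk (B ⊕ₗ A) = Cardinal.mk B + Cardinal.mk A := Cardinal.mk_congr ofLex
    rw [this, Cardinal.mk_ord_toType]
    exact (Cardinal.add_eq_left (hα.aleph0_le.trans hB) hB).symm
  obtain ⟨e⟩ := Cardinal.eq.1 hcard
  obtain ⟨oB⟩ : Nonempty (LinearOrder B) := ⟨linearOrderOfSTO WellOrderingRel⟩
  have : Nonempty A := Ordinal.nonempty_toType_iff.2 hα.ord_pos.ne'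
  have hcof : Order.cof (B ⊕ₗ A) = α := by
    rw [← Order.cof_congr_of_strictMono (f := fun a : A => (Sum.inrₗ a : B ⊕ₗ A))
      Sum.Lex.inr_strictMono, Ordinal.cof_toType, hα.cof_ord]
    rintro (b | a)
    · exact ⟨_, ⟨Classical.arbitrary A, rfl⟩, Sum.Lex.inl_le_inr _ _⟩
    · exact ⟨_, ⟨a, rfl⟩, le_rfl⟩
  obtain ⟨o, ho⟩ := exists_linearOrder_cof_eq e
  exact ⟨o.le, o, fun _ _ => Iff.rfl, ho.trans hcof⟩

/-! ### Inequations between constants in a fragment -/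

/-- The constants of an extended rigid sort; the nominals for the sort `any`. -/
def Sig.ECst (Δ : Sig.{u}) : Δ.ESrt → Type u
  | none => Δ.Nom
  | some s => Δ.RF 0 (fun i => i.elim0) s

/-- The value of a constant. -/
def Kripke.ecval {Δ : Sig.{u}} (M : Kripke Δ) : (e : Δ.ESrt) → Δ.ECst e → M.ECarrier e
  | none, k => M.nom k
  | some _, σ => M.rf σ (fun i => i.elim0)

section

variable {Δ : Sig.{u}} {C X : Δ.ESrt → Type u}

/-- The elements of `C` as constants of `Δ[C]`. -/
def Sig.newCst : (e : Δ.ESrt) → C e → (Δ.add C).ECst e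
  | none, c => .inr c
  | some _, c => .new c

/-- The constants of `Δ` as constants of `Δ[C]`. -/
def Sig.oldCst (C : Δ.ESrt → Type u) : (e : Δ.ESrt) → Δ.ECst e → (Δ.add C).ECst e
  | none, k => .inl k
  | some _, σ => .old σ

theorem Kripke.ecval_newCst (M : Kripke Δ) (v : ∀ e, C e → M.ECarrier e) (e : Δ.ESrt) (c : C e) :
    (M.expand v).ecval e (Sig.newCst e c) = M.toExpand v e (v e c) := by
  cases e <;> rfl

theorem Kripke.toExpand_inj (M : Kripke Δ) (v : ∀ e, C e → M.ECarrier e) (e : Δ.ESrt)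
    {x y : M.ECarrier e} : M.toExpand v e x = M.toExpand v e y ↔ x = y :=
  (M.toExpand_bijective v e).1.eq_iff

end

theorem Kripke.models_union {Δ : Sig.{u}} {M : Kripke Δ} {S T : Set (Sen Δ)} :
    M.Models (S ∪ T) ↔ M.Models S ∧ M.Models T := by
  simp only [Kripke.Models, Set.mem_union, or_imp, forall_and]

namespace Fragment

/-- A property of structures and worlds is definable in `L` if some `L`-sentence expresses it. -/
def Definable (L : Fragment.{u}) (Δ : Sig.{u}) (P : (M : Kripke Δ) → M.W → Prop) : Prop :=
  ∃ φ ∈ L.sen Δ, ∀ (M : Kripke Δ) (w : M.W), φ.Sat M w ↔ P M w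

variable {L : Fragment.{u}} {Δ : Sig.{u}}

theorem definable_ecval_eq (hEq : L.ClosedEq) (hRet : L.ClosedRet) (hΔ : Δ ∈ L.sig) (e : Δ.ESrt)
    (x y : Δ.ECst e) : L.Definable Δ (fun M _ => M.ecval e x = M.ecval e y) := by
  cases e with
  | none =>
    obtain ⟨φ, hφ, h⟩ := (hEq Δ hΔ).1 x
    obtain ⟨ψ, hψ, h'⟩ := hRet Δ hΔ y φ hφ
    exact ⟨ψ, hψ, fun M w => (h' M w).trans (h M (M.nom y))⟩
  | some s =>
    obtain ⟨φ, hφ, h⟩ := (hEq Δ hΔ).2 (.rig s) (.rig x fun i => i.elim0) (.rig y fun i => i.elim0)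
    refine ⟨φ, hφ, fun M w => (h M w).trans (iff_of_eq (congrArg₂ Eq ?_ ?_))⟩
    · exact congrArg (M.rf x) (funext fun i => i.elim0)
    · exact congrArg (M.rf y) (funext fun i => i.elim0)

theorem Definable.not (hNeg : L.ClosedNeg) (hΔ : Δ ∈ L.sig)
    {P : (M : Kripke Δ) → M.W → Prop} (hP : L.Definable Δ P) :
    L.Definable Δ (fun M w => ¬ P M w) := by
  obtain ⟨φ, hφ, h⟩ := hP
  obtain ⟨ψ, hψ, h'⟩ := hNeg Δ hΔ φ hφ
  exact ⟨ψ, hψ, fun M w => (h' M w).trans (not_congr (h M w))⟩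

theorem Definable.or (hDisj : L.ClosedDisj) (hΔ : Δ ∈ L.sig)
    {P Q : (M : Kripke Δ) → M.W → Prop} (hP : L.Definable Δ P) (hQ : L.Definable Δ Q) :
    L.Definable Δ (fun M w => P M w ∨ Q M w) := by
  obtain ⟨φ, hφ, h⟩ := hP
  obtain ⟨ψ, hψ, h'⟩ := hQ
  obtain ⟨χ, hχ, h''⟩ := hDisj Δ hΔ 2 ![φ, ψ] (by
    intro i
    fin_cases i
    · exact hφ
    · exact hψ)
  refine ⟨χ, hχ, fun M w => (h'' M w).trans ?_⟩
  refine (Fin.exists_fin_two (p := fun i => (![φ, ψ] i).Sat M w)).trans ?_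
  exact or_congr (h M w) (h' M w)

/-- The `L`-sentences that express, for some quadruple `x`, `y`, `z`, `t` in `Q`, that not both
`x = y` and `z = t`. -/
def prohibitions (L : Fragment.{u}) (Δ : Sig.{u}) (e : Δ.ESrt)
    (Q : Δ.ECst e → Δ.ECst e → Δ.ECst e → Δ.ECst e → Prop) : Set (Sen Δ) :=
  {φ | φ ∈ L.sen Δ ∧ ∃ x y z t, Q x y z t ∧ ∀ (M : Kripke Δ) (w : M.W), φ.Sat M w ↔
    ¬ (M.ecval e x = M.ecval e y ∧ M.ecval e z = M.ecval e t)}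

theorem models_prohibitions (hEq : L.ClosedEq) (hRet : L.ClosedRet) (hNeg : L.ClosedNeg)
    (hDisj : L.ClosedDisj) (hΔ : Δ ∈ L.sig) {e : Δ.ESrt}
    {Q : Δ.ECst e → Δ.ECst e → Δ.ECst e → Δ.ECst e → Prop} {M : Kripke Δ} :
    M.Models (L.prohibitions Δ e Q) ↔ ∀ x y z t, Q x y z t →
      ¬ (M.ecval e x = M.ecval e y ∧ M.ecval e z = M.ecval e t) := by
  constructor
  · intro h x y z t hQ
    obtain ⟨φ, hφ, h'⟩ := ((definable_ecval_eq hEq hRet hΔ e x y).not hNeg hΔ).or hDisj hΔ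
      ((definable_ecval_eq hEq hRet hΔ e z t).not hNeg hΔ)
    have h'' : ∀ (M : Kripke Δ) (w : M.W), φ.Sat M w ↔
        ¬ (M.ecval e x = M.ecval e y ∧ M.ecval e z = M.ecval e t) := fun M w =>
      (h' M w).trans not_and_or.symm
    obtain ⟨w⟩ := M.W_nonempty
    exact (h'' M w).1 (h φ ⟨hφ, x, y, z, t, hQ, h''⟩ w)
  · rintro h φ ⟨-, x, y, z, t, hQ, hφ⟩ w
    exact (hφ M w).2 (h x y z t hQ)

/-- The `L`-sentences that express `x ≠ y` for some pair `x`, `y` in `Q`. -/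
def inequations (L : Fragment.{u}) (Δ : Sig.{u}) (e : Δ.ESrt)
    (Q : Δ.ECst e → Δ.ECst e → Prop) : Set (Sen Δ) :=
  L.prohibitions Δ e (fun x y z t => Q x y ∧ x = z ∧ y = t)

theorem models_inequations (hEq : L.ClosedEq) (hRet : L.ClosedRet) (hNeg : L.ClosedNeg)
    (hDisj : L.ClosedDisj) (hΔ : Δ ∈ L.sig) {e : Δ.ESrt} {Q : Δ.ECst e → Δ.ECst e → Prop}
    {M : Kripke Δ} :
    M.Models (L.inequations Δ e Q) ↔ ∀ x y, Q x y → M.ecval e x ≠ M.ecval e y := by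
  rw [inequations, models_prohibitions hEq hRet hNeg hDisj hΔ]
  constructor
  · intro h x y hQ e
    exact h x y x y ⟨hQ, rfl, rfl⟩ ⟨e, e⟩
  · rintro h x y _ _ ⟨hQ, rfl, rfl⟩ ⟨e, -⟩
    exact h x y hQ e

/-! ### A criterion for omitting -/

/-- A type over `Δ[C]` is `α`-omitted by a theory if, in every model of the theory, any fewer than
`α` of the constants in `C` can be held fixed while the others are reinterpreted so that the
theory remains true and a given tuple does not realize the type. -/
theorem not_alphaRealizes {α : Cardinal.{u}} (hα : α.IsRegular) {C : Δ.ESrt → Type u}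
    {X : Δ.ESrt → Type u} (hX : Finite (Σ e, X e)) {T : Set (Sen Δ)} {S : Set (Sen (Δ.add C))}
    {Γ : Set (Sen ((Δ.add C).add X))}
    (H : ∀ (M : Kripke Δ) (u : ∀ e, C e → M.ECarrier e), (M.expand u).Models S →
      ∀ K : Set (Σ e, C e), Cardinal.mk K < α → ∀ x : (∀ e, X e → M.ECarrier e),
        ∃ u' : ∀ e, C e → M.ECarrier e, (∀ c ∈ K, u c.1 c.2 = u' c.1 c.2) ∧
          (M.expand u').Models S ∧ ¬ (M.expand₂ u' x).Models Γ) :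
    ¬ L.AlphaRealizes α ((fun γ => γ.tr (Hom.incl Δ C).toTrans) '' T ∪ S) Γ := by
  rintro ⟨C', -, θ, p, -, hp, ⟨M', hM'⟩, hent⟩
  obtain ⟨M, u, v, rfl⟩ := M'.exists_eq_expand₂
  rw [Kripke.models_union, Kripke.models_image_incl, Kripke.models_union,
    Kripke.models_image_incl] at hM'
  obtain ⟨⟨hMT, hMS⟩, hMp⟩ := hM'
  choose K₁ hK₁ H₁ using fun γ : Sen ((Δ.add C).add C') => γ.exists_finite_constants
  choose K₂ hK₂ H₂ using fun x : Σ e, X e => θ.exists_finite_constants x.1 x.2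
  obtain ⟨p', hp'⟩ : ∃ p' : Type u, Nonempty (ULift.{u + 1} p' ≃ p) := by
    obtain ⟨c, hc⟩ := Cardinal.mem_range_lift_of_le hp.le
    refine ⟨c.out, Cardinal.eq.1 ?_⟩
    rw [Cardinal.mk_uLift, Cardinal.mk_out, hc]
  obtain ⟨f⟩ := hp'
  have hfin : ∀ K : Set (Σ e, C e), K.Finite → Cardinal.mk K < α := fun K hK =>
    hK.lt_aleph0.trans_le hα.aleph0_le
  have hp'α : Cardinal.mk p' < α := by
    rw [← Cardinal.mk_congr f, Cardinal.mk_uLift, Cardinal.lift_lt] at hp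
    exact hp
  obtain ⟨u', huu', hS, hΓ⟩ := H M u hMS
    ((⋃ i : p', K₁ (f ⟨i⟩)) ∪ ⋃ x, K₂ x) ((Cardinal.mk_union_le _ _).trans_lt
      (Cardinal.add_lt_of_lt hα.aleph0_le
        ((Cardinal.card_iUnion_lt_iff_forall_of_isRegular hα hp'α).2 fun i => hfin _ (hK₁ _))
        (hfin _ (Set.finite_iUnion hK₂)))) (θ.val₂ M u v)
  refine hΓ fun γ hγ w => ?_
  have hval : θ.val₂ M u v = θ.val₂ M u' v := by
    funext e x
    exact H₂ ⟨e, x⟩ M u u' v fun c hc => huu' c (.inr (Set.mem_iUnion.2 ⟨_, hc⟩))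
  rw [hval, ← Sen.sat_tr_subst₂]
  refine hent (M.expand₂ u' v) ?_ _ ⟨γ, hγ, rfl⟩ w
  rw [Kripke.models_union, Kripke.models_image_incl, Kripke.models_union,
    Kripke.models_image_incl]
  refine ⟨⟨hMT, hS⟩, fun φ hφ w => ?_⟩
  refine (H₁ φ M u u' v (fun c hc => huu' c (.inl (Set.mem_iUnion.2 ?_))) w).1 (hMp φ hφ w)
  exact ⟨(f.symm ⟨φ, hφ⟩).down, by
    change c ∈ K₁ (f (f.symm ⟨φ, hφ⟩)).1
    rwa [f.apply_symm_apply]⟩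

end Fragment

/-! ### The power of a signature with added constants -/

theorem Sig.power_add_le {Δ : Sig.{u}} {α : Cardinal.{u}} (hΔ : Δ.power ≤ α)
    (C : Δ.ESrt → Type u) (hC : ∀ e, Cardinal.mk (C e) ≤ α) : (Δ.add C).power ≤ α := by
  obtain ⟨hα, h⟩ := max_le_iff.1 hΔ
  have hadd : ∀ {a b : Cardinal.{u}}, a ≤ α → b ≤ α → a + b ≤ α :=
    fun ha hb => Cardinal.add_le_of_le hα ha hb
  have hR := (self_le_add_left _ _).trans h
  have h₁ := (self_le_add_right _ _).trans h
  have hF := (self_le_add_left _ _).trans h₁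
  have h₂ := (self_le_add_right _ _).trans h₁
  have hS := (self_le_add_left _ _).trans h₂
  have h₃ := (self_le_add_right _ _).trans h₂
  have hM := (self_le_add_left _ _).trans h₃
  have hN := (self_le_add_right _ _).trans h₃
  have hRS : Cardinal.mk Δ.RS ≤ α :=
    (Cardinal.mk_le_of_injective (f := (Sum.inl : Δ.RS → Δ.Srt)) Sum.inl_injective).trans hS
  refine max_le hα (hadd (hadd (hadd (hadd ?_ hM) hS) ?_) ?_)
  · rw [Cardinal.mk_sum, Cardinal.lift_id, Cardinal.lift_id]
    exact hadd hN (hC none)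
  · have hnew : Cardinal.mk (Σ s : Δ.RS, C (some s)) ≤ α := by
      rw [Cardinal.mk_sigma]
      refine (Cardinal.sum_le_mk_mul_iSup _).trans ?_
      refine (mul_le_mul' hRS (ciSup_le' fun s => hC (some s))).trans ?_
      exact (Cardinal.mul_eq_self hα).le
    refine le_trans ?_ (hadd hF hnew)
    rw [Cardinal.add_def]
    refine Cardinal.mk_le_of_surjective (f := Sum.elim
      (fun x => ⟨x.1, x.2.1, x.2.2.1, match x.2.2.2 with
        | .rig ar s ha hb σ => .rig ar s ha hb (.old σ)
        | .flex σ => .flex σ⟩)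
      (fun x => ⟨0, fun i => i.elim0, .inl x.1,
        .rig (fun i => i.elim0) x.1 (fun i => i.elim0) rfl (.new x.2)⟩)) ?_
    rintro ⟨n, ar, s, σ⟩
    match n, ar, s, σ with
    | n, ar, s, .flex σ => exact ⟨.inl ⟨n, ar, s, .flex σ⟩, rfl⟩
    | n, ar, s, .rig ar' s' ha hb (.old σ) =>
      exact ⟨.inl ⟨n, ar, s, .rig ar' s' ha hb σ⟩, rfl⟩
    | _, ar, _, .rig ar' s' ha rfl (.new c) =>
      obtain rfl : ar = fun i => i.elim0 := Subsingleton.elim _ _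
      obtain rfl : ar' = fun i => i.elim0 := Subsingleton.elim _ _
      exact ⟨.inr ⟨s', c⟩, rfl⟩
  · refine le_trans ?_ hR
    refine Cardinal.mk_le_of_surjective (f := fun x => ⟨x.1, x.2.1, match x.2.2 with
        | .rig ar ha π => .rig ar ha π
        | .flex π => .flex π⟩) ?_
    rintro ⟨n, ar, ⟨ar', ha, π⟩ | π⟩
    · exact ⟨⟨n, ar, .rig ar' ha π⟩, rfl⟩
    · exact ⟨⟨n, ar, .flex π⟩, rfl⟩

/-! ### The theory and the types -/

theorem Kripke.nonempty_eCarrier {Δ : Sig.{u}} (M : Kripke Δ) (e : Δ.ESrt) :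
    Nonempty (M.ECarrier e) := by
  cases e with
  | none => exact M.W_nonempty
  | some s => exact M.R_nonempty s

/-- The sorted set that consists of one variable of the sort `e₀`. -/
def Sig.single (Δ : Sig.{u}) (e₀ : Δ.ESrt) : Δ.ESrt → Type u := fun e => ULift (PLift (e = e₀))

theorem Sig.finite_single (Δ : Sig.{u}) (e₀ : Δ.ESrt) : Finite (Σ e, Δ.single e₀ e) := by
  have : Subsingleton (Σ e, Δ.single e₀ e) :=
    ⟨fun ⟨_, ⟨⟨h⟩⟩⟩ ⟨_, ⟨⟨h'⟩⟩⟩ => by subst h h'; rfl⟩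
  infer_instance

/-- The variable of the sort `e₀`. -/
def Sig.singleVar {Δ : Sig.{u}} {e₀ : Δ.ESrt} : Δ.single e₀ e₀ := ⟨⟨rfl⟩⟩

/-- `Δ` with a copy of the constants `Cst A` added to each extended rigid sort. -/
abbrev Sig.addCst (Δ : Sig.{u}) (A : Type u) : Sig.{u} := Δ.add fun _ => Cst A

section

variable {Δ : Sig.{u}} {C X : Δ.ESrt → Type u} (M : Kripke Δ) (u : ∀ e, C e → M.ECarrier e)
  (v : ∀ e, X e → M.ECarrier e) (e : Δ.ESrt)

theorem Kripke.ecval_old_eq_old_iff (c c' : C e) :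
    (M.expand₂ u v).ecval e (Sig.oldCst (Δ := Δ.add C) X e (Sig.newCst e c)) =
      (M.expand₂ u v).ecval e (Sig.oldCst (Δ := Δ.add C) X e (Sig.newCst e c')) ↔
    u e c = u e c' := by
  cases e <;> exact Iff.rfl

theorem Kripke.ecval_old_eq_new_iff (c : C e) (x : X e) :
    (M.expand₂ u v).ecval e (Sig.oldCst (Δ := Δ.add C) X e (Sig.newCst e c)) =
      (M.expand₂ u v).ecval e (Sig.newCst (Δ := Δ.add C) (C := X) e x) ↔ u e c = v e x := by
  cases e <;> exact Iff.rfl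

end

namespace Fragment

variable (L : Fragment.{u}) (Δ : Sig.{u}) {A : Type u}

/-- The type of the elements that are not named by any `a n` or `b j`. -/
def unnamedType (A : Type u) (e : Δ.ESrt) : Set (Sen ((Δ.addCst A).add (Δ.single e))) :=
  L.inequations _ e fun x y => ∃ c : Cst A, ((∃ n, c = .a n) ∨ ∃ j, c = .b j) ∧
    x = Sig.oldCst (Δ := Δ.addCst A) (Δ.single e) e (Sig.newCst e c) ∧
    y = Sig.newCst (Δ := Δ.addCst A) (C := Δ.single e) e Sig.singleVar

variable {L Δ} in
theorem models_unnamedType (hEq : L.ClosedEq) (hRet : L.ClosedRet) (hNeg : L.ClosedNeg)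
    (hDisj : L.ClosedDisj) (hΔ : Δ ∈ L.sig) {e : Δ.ESrt} {M : Kripke Δ}
    {u : ∀ e, Cst A → M.ECarrier e} {x : ∀ e', Δ.single e e' → M.ECarrier e'} :
    (M.expand₂ u x).Models (L.unnamedType Δ A e) ↔
      (∀ n, u e (.a n) ≠ x e Sig.singleVar) ∧ ∀ j, u e (.b j) ≠ x e Sig.singleVar := by
  have hΔ' := L.add_mem _ (L.add_mem Δ hΔ fun _ => Cst A) (Δ.single e)
  rw [unnamedType, models_inequations hEq hRet hNeg hDisj hΔ']
  have key := fun c : Cst A => M.ecval_old_eq_new_iff u x e c Sig.singleVar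
  constructor
  · intro H
    exact ⟨fun n => (key _).not.1 (H _ _ ⟨_, .inl ⟨n, rfl⟩, rfl, rfl⟩),
      fun j => (key _).not.1 (H _ _ ⟨_, .inr ⟨j, rfl⟩, rfl, rfl⟩)⟩
  · rintro ⟨h₁, h₂⟩ _ _ ⟨_, ⟨n, rfl⟩ | ⟨j, rfl⟩, rfl, rfl⟩
    · exact (key _).not.2 (h₁ n)
    · exact (key _).not.2 (h₂ j)

variable [LinearOrder A]

/-- The theory of the structures that interpret the new constants of the sorts in `Ω`
admissibly. -/
def cstTheory (Ω : Set Δ.ESrt) (l : A → ℕ → A) : Set (Sen (Δ.addCst A)) :=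
  {φ | ∃ e ∈ Ω, φ ∈ L.prohibitions (Δ.addCst A) e fun x y z t => ∃ x' y' z' t',
    Forbidden l x' y' z' t' ∧ x = Sig.newCst e x' ∧ y = Sig.newCst e y' ∧
      z = Sig.newCst e z' ∧ t = Sig.newCst e t'}

/-- The type, without any condition on its variable, that says that the set of all `k` with
`c k = a 0` is bounded by `j`. -/
def boundedType (e : Δ.ESrt) (j : A) : Set (Sen ((Δ.addCst A).add (Δ.single e))) :=
  L.inequations _ e fun x y => ∃ k, j < k ∧
    x = Sig.oldCst (Δ := Δ.addCst A) (Δ.single e) e (Sig.newCst (C := fun _ => Cst A) e (.c k)) ∧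
    y = Sig.oldCst (Δ := Δ.addCst A) (Δ.single e) e (Sig.newCst (C := fun _ => Cst A) e (.a 0))

variable {L Δ}

theorem models_cstTheory (hEq : L.ClosedEq) (hRet : L.ClosedRet) (hNeg : L.ClosedNeg)
    (hDisj : L.ClosedDisj) (hΔ : Δ ∈ L.sig) {Ω : Set Δ.ESrt} {l : A → ℕ → A} {M : Kripke Δ}
    {u : ∀ e, Cst A → M.ECarrier e} :
    (M.expand u).Models (L.cstTheory Δ Ω l) ↔ ∀ e ∈ Ω, Admissible l (u e) := by
  have hΔ' : Δ.addCst A ∈ L.sig := L.add_mem Δ hΔ _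
  have h : (M.expand u).Models (L.cstTheory Δ Ω l) ↔ ∀ e ∈ Ω, (M.expand u).Models
      (L.prohibitions (Δ.addCst A) e fun x y z t => ∃ x' y' z' t',
        Forbidden l x' y' z' t' ∧ x = Sig.newCst e x' ∧ y = Sig.newCst e y' ∧
          z = Sig.newCst e z' ∧ t = Sig.newCst e t') :=
    ⟨fun h e he φ hφ => h φ ⟨e, he, hφ⟩, fun h φ ⟨e, he, hφ⟩ => h e he φ hφ⟩
  rw [h]
  refine forall₂_congr fun e _ => ?_
  rw [models_prohibitions hEq hRet hNeg hDisj hΔ']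
  constructor
  · intro H x y z t hf
    have := H _ _ _ _ ⟨x, y, z, t, hf, rfl, rfl, rfl, rfl⟩
    simpa only [Kripke.ecval_newCst, Kripke.toExpand_inj] using this
  · rintro H _ _ _ _ ⟨x, y, z, t, hf, rfl, rfl, rfl, rfl⟩
    simpa only [Kripke.ecval_newCst, Kripke.toExpand_inj] using H x y z t hf

theorem models_boundedType (hEq : L.ClosedEq) (hRet : L.ClosedRet) (hNeg : L.ClosedNeg)
    (hDisj : L.ClosedDisj) (hΔ : Δ ∈ L.sig) {e : Δ.ESrt} {j : A} {M : Kripke Δ}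
    {u : ∀ e, Cst A → M.ECarrier e} {x : ∀ e', Δ.single e e' → M.ECarrier e'} :
    (M.expand₂ u x).Models (L.boundedType Δ e j) ↔ ∀ k, j < k → u e (.c k) ≠ u e (.a 0) := by
  have hΔ' := L.add_mem _ (L.add_mem Δ hΔ fun _ => Cst A) (Δ.single e)
  rw [boundedType, models_inequations hEq hRet hNeg hDisj hΔ']
  have key := fun c c' : Cst A => M.ecval_old_eq_old_iff u x e c c'
  constructor
  · intro H k hk
    exact (key _ _).not.1 (H _ _ ⟨k, hk, rfl, rfl⟩)
  · rintro H _ _ ⟨k, hk, rfl, rfl⟩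
    exact (key _ _).not.2 (H k hk)

open Classical in
/-- The criterion for omitting, for types that concern a single sort `e₀ ∈ Ω`: it suffices to
change the interpretation of the new constants of that sort, from an index `β` on. -/
theorem not_alphaRealizes_cstTheory (hEq : L.ClosedEq) (hRet : L.ClosedRet) (hNeg : L.ClosedNeg)
    (hDisj : L.ClosedDisj) (hΔ : Δ ∈ L.sig) {α : Cardinal.{u}} (hα : α.IsRegular)
    (hA : Order.cof A = α) (T : Set (Sen Δ)) {Ω : Set Δ.ESrt} {l : A → ℕ → A} {e₀ : Δ.ESrt}
    (he₀ : e₀ ∈ Ω) {Γ : Set (Sen ((Δ.addCst A).add (Δ.single e₀)))}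
    (H : ∀ (M : Kripke Δ) (u : ∀ e, Cst A → M.ECarrier e), Admissible l (u e₀) →
      ∀ (β : A) (x : ∀ e, Δ.single e₀ e → M.ECarrier e),
        ∃ v : Cst A → M.ECarrier e₀, Admissible l v ∧
          (∀ c : Cst A, (∀ i ∈ c.index, i < β) → v c = u e₀ c) ∧
          ¬ (M.expand₂ (Function.update u e₀ v) x).Models Γ) :
    ¬ L.AlphaRealizes α
      ((fun γ => γ.tr (Hom.incl Δ fun _ => Cst A).toTrans) '' T ∪ L.cstTheory Δ Ω l) Γ := by
  refine not_alphaRealizes hα (Δ.finite_single e₀) ?_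
  intro M u hu K hK x
  rw [models_cstTheory hEq hRet hNeg hDisj hΔ] at hu
  have : Nonempty A := Order.cof_ne_zero_iff.1 (hA ▸ hα.pos.ne')
  obtain ⟨β, hβ⟩ := exists_gt_of_mk_lt_cof
    (s := Set.range fun c : K => c.1.2.index.getD (Classical.arbitrary A))
    (by rw [hA]; exact Cardinal.mk_range_le.trans_lt hK)
  obtain ⟨v, hv, hvu, hΓ⟩ := H M u (hu e₀ he₀) β x
  refine ⟨Function.update u e₀ v, ?_, ?_, hΓ⟩
  · rintro ⟨e, c⟩ hc
    by_cases he : e = e₀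
    · subst he
      rw [Function.update_self, hvu]
      intro i hi
      refine hβ i ⟨⟨⟨e, c⟩, hc⟩, ?_⟩
      simp [Option.mem_def.1 hi]
    · rw [Function.update_of_ne he]
  · rw [models_cstTheory hEq hRet hNeg hDisj hΔ]
    intro e he
    by_cases he' : e = e₀
    · subst he'
      rwa [Function.update_self]
    · rw [Function.update_of_ne he']
      exact hu e he

open Classical in
theorem not_alphaRealizes_unnamedType (hEq : L.ClosedEq) (hRet : L.ClosedRet)
    (hNeg : L.ClosedNeg) (hDisj : L.ClosedDisj) (hΔ : Δ ∈ L.sig) {α : Cardinal.{u}}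
    (hα : α.IsRegular) (hA : Order.cof A = α) (T : Set (Sen Δ)) {Ω : Set Δ.ESrt} {l : A → ℕ → A}
    {e₀ : Δ.ESrt} (he₀ : e₀ ∈ Ω) :
    ¬ L.AlphaRealizes α
      ((fun γ => γ.tr (Hom.incl Δ fun _ => Cst A).toTrans) '' T ∪ L.cstTheory Δ Ω l)
      (L.unnamedType Δ A e₀) := by
  refine not_alphaRealizes_cstTheory hEq hRet hNeg hDisj hΔ hα hA T he₀ ?_
  intro M u hu β x
  by_cases hx : ∀ n, u e₀ (.a n) ≠ x e₀ Sig.singleVar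
  · obtain ⟨v, hv, hvb, -, hvu⟩ := hu.exists_modification β _ (x e₀ Sig.singleVar) hx
    refine ⟨v, hv, hvu, fun h => ?_⟩
    rw [models_unnamedType hEq hRet hNeg hDisj hΔ, Function.update_self] at h
    exact h.2 β hvb
  · refine ⟨u e₀, hu, fun _ _ => rfl, fun h => hx ?_⟩
    rw [models_unnamedType hEq hRet hNeg hDisj hΔ, Function.update_self] at h
    exact h.1

open Classical in
theorem not_alphaRealizes_boundedType (hEq : L.ClosedEq) (hRet : L.ClosedRet)
    (hNeg : L.ClosedNeg) (hDisj : L.ClosedDisj) (hΔ : Δ ∈ L.sig) {α : Cardinal.{u}}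
    (hα : α.IsRegular) (hA : Order.cof A = α) (T : Set (Sen Δ)) {Ω : Set Δ.ESrt} {l : A → ℕ → A}
    {e₀ : Δ.ESrt} (he₀ : e₀ ∈ Ω) (j : A) :
    ¬ L.AlphaRealizes α
      ((fun γ => γ.tr (Hom.incl Δ fun _ => Cst A).toTrans) '' T ∪ L.cstTheory Δ Ω l)
      (L.boundedType Δ e₀ j) := by
  refine not_alphaRealizes_cstTheory hEq hRet hNeg hDisj hΔ hα hA T he₀ ?_
  intro M u hu β x
  obtain ⟨β', hβ'⟩ := exists_gt_of_mk_lt_cof (s := {β, j}) (by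
    rw [hA]; exact (Set.toFinite _).lt_aleph0.trans_le hα.aleph0_le)
  obtain ⟨v, hv, -, hvc, hvu⟩ := hu.exists_modification β' (u e₀ (.b β')) (u e₀ (.a 0))
    fun n => (admissible_iff.1 hu).2.1 n β'
  refine ⟨v, hv, fun c hc => hvu c fun i hi => (hc i hi).trans (hβ' β (by simp)), fun h => ?_⟩
  rw [models_boundedType hEq hRet hNeg hDisj hΔ, Function.update_self] at h
  exact h β' (hβ' j (by simp)) (hvc.trans (hvu (.a 0) (by simp [Cst.index])).symm)

end Fragment

/-! ### Large models -/

theorem mk_cst_le {A : Type u} {α : Cardinal.{u}} (hα : Cardinal.aleph0 ≤ α)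
    (hA : Cardinal.mk A ≤ α) : Cardinal.mk (Cst A) ≤ α := by
  have h : Cardinal.mk (ULift.{u} ℕ ⊕ A × ULift.{u} (Fin 3)) ≤ α := by
    rw [← Cardinal.add_def, ← Cardinal.mul_def]
    refine Cardinal.add_le_of_le hα (by simpa using hα) ?_
    refine (mul_le_mul' hA (?_ : _ ≤ α)).trans (Cardinal.mul_eq_self hα).le
    exact Cardinal.mk_le_aleph0.trans hα
  refine (Cardinal.mk_le_of_surjective (f := Sum.elim (fun n => Cst.a n.down)
    (fun x => match x.2.down with
      | 0 => Cst.b x.1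
      | 1 => Cst.c x.1
      | 2 => Cst.d x.1)) ?_).trans h
  rintro (n | j | k | i)
  · exact ⟨.inl ⟨n⟩, rfl⟩
  · exact ⟨.inr (j, ⟨0⟩), rfl⟩
  · exact ⟨.inr (k, ⟨1⟩), rfl⟩
  · exact ⟨.inr (i, ⟨2⟩), rfl⟩

open Classical in
/-- The `α`-omitting types property, applied to the theory of admissible interpretations and to the
types `unnamedType` and `boundedType` of all sorts that are infinite in `M`, gives large models. -/
theorem Fragment.HasOTP.exists_large_model {L : Fragment.{u}}
    (hEq : L.ClosedEq) (hRet : L.ClosedRet) (hNeg : L.ClosedNeg) (hDisj : L.ClosedDisj)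
    {α : Cardinal.{u}} (hα : α.IsRegular) (hOTP : L.HasOTP α)
    {Δ : Sig.{u}} (hΔ : Δ ∈ L.sig) (hpow : Δ.power ≤ α) {T : Set (Sen Δ)} (hT : T ⊆ L.sen Δ)
    {M : Kripke Δ} (hM : M.Models T) :
    ∃ N : Kripke Δ, N.Models T ∧
      ∀ e : Δ.ESrt, Infinite (M.ECarrier e) → α ≤ Cardinal.mk (N.ECarrier e) := by
  -- For `α = ℵ₀` the given model will do.
  rcases hα.aleph0_le.eq_or_lt with rfl | hα'
  · exact ⟨M, hM, fun e he => Cardinal.aleph0_le_mk _⟩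
  by_cases hΩ : ∃ e : Δ.ESrt, Infinite (M.ECarrier e)
  swap
  · exact ⟨M, hM, fun e he => absurd ⟨e, he⟩ hΩ⟩
  let Ω : Set Δ.ESrt := {e | Infinite (M.ECarrier e)}
  have : Nonempty Ω := hΩ.elim fun e he => ⟨⟨e, he⟩⟩
  let A := α.ord.ToType
  have hA : Order.cof A = α := by rw [Ordinal.cof_toType, hα.cof_ord]
  have hAα : Cardinal.mk A = α := Cardinal.mk_ord_toType α
  obtain ⟨l, hl⟩ := exists_ladders (A := A)
  have hΔ' : Δ.addCst A ∈ L.sig := L.add_mem Δ hΔ _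
  have hpow' : (Δ.addCst A).power ≤ α :=
    Sig.power_add_le hpow _ fun _ => mk_cst_le hα.aleph0_le hAα.le
  have hT' : (fun γ => γ.tr (Hom.incl Δ fun _ => Cst A).toTrans) '' T ∪ L.cstTheory Δ Ω l ⊆
      L.sen (Δ.addCst A) := by
    rintro _ (⟨γ, hγ, rfl⟩ | ⟨e, -, hφ, -⟩)
    · exact L.map_mem _ hΔ _ hΔ' _ (L.incl_mem _ hΔ _) _ (hT hγ)
    · exact hφ
  have hsat : Satisfiable
      ((fun γ => γ.tr (Hom.incl Δ fun _ => Cst A).toTrans) '' T ∪ L.cstTheory Δ Ω l) := by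
    have hu : ∀ e, ∃ u : Cst A → M.ECarrier e, e ∈ Ω → Admissible l u := fun e => by
      by_cases he : e ∈ Ω
      · have : Infinite (M.ECarrier e) := he
        obtain ⟨u, hu⟩ := exists_admissible (B := M.ECarrier e) l
        exact ⟨u, fun _ => hu⟩
      · exact ⟨fun _ => (M.nonempty_eCarrier e).some, fun h => absurd h he⟩
    choose u hu using hu
    refine ⟨M.expand u, ?_⟩
    rw [Kripke.models_union, Kripke.models_image_incl,
      Fragment.models_cstTheory hEq hRet hNeg hDisj hΔ]
    exact ⟨hM, hu⟩
  have hι : Cardinal.mk (Ω × Option A) = α := by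
    have hΩα : Cardinal.mk Ω ≤ α := by
      have hRS : Cardinal.mk Δ.RS ≤ α :=
        (Cardinal.mk_le_of_injective (f := (Sum.inl : Δ.RS → Δ.Srt)) Sum.inl_injective).trans
          (((self_le_add_left _ _).trans (self_le_add_right _ _)).trans
            ((self_le_add_right _ _).trans ((le_max_right _ _).trans hpow)))
      refine (Cardinal.mk_set_le _).trans ?_
      rw [Cardinal.mk_option]
      exact Cardinal.add_le_of_le hα.aleph0_le hRS (Cardinal.one_le_aleph0.trans hα.aleph0_le)
    rw [← Cardinal.mul_def, Cardinal.mk_option, hAα, Cardinal.add_one_eq hα.aleph0_le]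
    exact Cardinal.mul_eq_right hα.aleph0_le hΩα (Cardinal.mk_ne_zero _)
  obtain ⟨N', hN', homit⟩ := hOTP _ hΔ' hpow' _ hT' hsat (Ω × Option A) hι
    (fun i => Δ.single i.1.1) (fun i => Δ.finite_single i.1.1)
    (fun i => match i.2 with
      | none => L.unnamedType Δ A i.1.1
      | some j => L.boundedType Δ i.1.1 j)
    (by
      rintro ⟨e, _ | j⟩ φ hφ
      · exact hφ.1
      · exact hφ.1)
    (by
      rintro ⟨⟨e, he⟩, _ | j⟩
      · exact Fragment.not_alphaRealizes_unnamedType hEq hRet hNeg hDisj hΔ hα hA T he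
      · exact Fragment.not_alphaRealizes_boundedType hEq hRet hNeg hDisj hΔ hα hA T he j)
  obtain ⟨N, u, rfl⟩ := N'.exists_eq_expand
  rw [Kripke.models_union, Kripke.models_image_incl,
    Fragment.models_cstTheory hEq hRet hNeg hDisj hΔ] at hN'
  refine ⟨N, hN'.1, fun e he => ?_⟩
  have hreal : ∀ (x : N.ECarrier e) (i : Option A), ∃ v : ∀ e', Δ.single e e' → N.ECarrier e',
      v e Sig.singleVar = x ∧ ¬ (N.expand₂ u v).Models (match i with
        | none => L.unnamedType Δ A e
        | some j => L.boundedType Δ e j) := fun x i =>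
    ⟨fun _ h => h.down.down ▸ x, rfl, fun h => homit ⟨⟨e, he⟩, i⟩ ⟨_, h⟩⟩
  rw [← hA]
  refine (hN'.2 e he).cof_le_mk hl (hA.symm ▸ hα') (fun x => ?_) (fun j => ?_)
  · obtain ⟨v, rfl, hv⟩ := hreal x none
    rw [Fragment.models_unnamedType hEq hRet hNeg hDisj hΔ] at hv
    by_contra! h
    exact hv h
  · obtain ⟨v, -, hv⟩ := hreal (N.nonempty_eCarrier e).some (some j)
    rw [Fragment.models_boundedType hEq hRet hNeg hDisj hΔ] at hv
    by_contra! h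
    exact hv h

/-- Any binary relations on the carriers of the sorts in `Ω` are interpretations of the new
symbols in some expansion. -/
theorem Kripke.exists_forgetOrders_eq {Δ : Sig.{u}} (N : Kripke Δ) {Ω : Set Δ.ESrt}
    (r : ∀ e ∈ Ω, N.ECarrier e → N.ECarrier e → Prop) :
    ∃ N' : Kripke (Δ.addOrders Ω), N'.forgetOrders = N ∧
      ∀ (e : Δ.ESrt) (he : e ∈ Ω) (α : Cardinal.{u}), IsLinearOrderOfCof (r e he) α →
        IsLinearOrderOfCof (N'.ordRel e he) α := by
  refine ⟨{
    W := N.W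
    W_nonempty := N.W_nonempty
    R := N.R
    R_nonempty := N.R_nonempty
    F := N.F
    F_nonempty := N.F_nonempty
    nom := N.nom
    mod := fun l => match l with
      | .old l => N.mod l
      | .le h => r none h
    rf := N.rf
    ff := N.ff
    rp := fun {_ _} π => match π with
      | .old π => N.rp π
      | .le s h => fun x => r (some s) h (x 0) (x 1)
    fp := N.fp }, rfl, ?_⟩
  rintro (_ | s) he α h
  · exact h
  · exact h

end HDFOLR

theorem mainTheorem5 (L : HDFOLR.Fragment.{u})
    (hEq : L.ClosedEq) (hRet : L.ClosedRet) (hNeg : L.ClosedNeg) (hDisj : L.ClosedDisj)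
    (hDia : L.ClosedDia) (hEx : L.ClosedEx)
    (α : Cardinal.{u}) (hα : α.IsRegular) (hOTP : L.HasOTP α)
    (Δ : HDFOLR.Sig.{u}) (hΔ : Δ ∈ L.sig) (hpow : Δ.power ≤ α)
    (T : Set (HDFOLR.Sen Δ)) (hT : T ⊆ L.sen Δ)
    (M : HDFOLR.Kripke Δ) (hM : M.Models T) :
    ∃ N : HDFOLR.Kripke Δ, N.Models T ∧
      (∀ e : Δ.ESrt, Infinite (M.ECarrier e) → α ≤ Cardinal.mk (N.ECarrier e)) ∧
      ∃ N' : HDFOLR.Kripke (Δ.addOrders {e | Infinite (M.ECarrier e)}), N'.forgetOrders = N ∧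
        ∀ (e : Δ.ESrt) (he : e ∈ {e : Δ.ESrt | Infinite (M.ECarrier e)}),
          HDFOLR.IsLinearOrderOfCof (N'.ordRel e he) α := by
  obtain ⟨N, hN, hlarge⟩ := hOTP.exists_large_model hEq hRet hNeg hDisj hα hΔ hpow hT hM
  choose r hr using fun (e : Δ.ESrt) (he : e ∈ {e : Δ.ESrt | Infinite (M.ECarrier e)}) =>
    HDFOLR.exists_isLinearOrderOfCof hα (hlarge e he)
  obtain ⟨N', hN', h⟩ := N.exists_forgetOrders_eq r
  exact ⟨N, hN, hlarge, N', hN', fun e he => h e he α (hr e he)⟩
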